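/- For $A\in\mathbb R^{n\times n}$ let $\|A\|_1$ be the trace norm (the sum of the singular values) and $\|A\|$ the spectral norm. There exist absolute constants $K_1,K_2>0$ such that the following holds for all integers $n,r,M\ge 0$. Let $f:\mathbb R^n\to\mathbb R$ be twice differentiable with $L_2$-Lipschitz Hessian, i.e. for some $L_2>0$, $\|\nabla^2 f(y)-\nabla^2 f(z)\|\le L_2\|y-z\|$ for all $y,z\in\mathbb R^n$; fix $x\in\mathbb R^n$ and suppose that $\nabla^2 f(x)$ has rank $r$. Let $a_1,\dots,a_M$ be i.i.d. standard Gaussian vectors $\mathcal N(0,I_n)$, and consider the trace-norm minimization problem $$\min_{\widehat H\in\mathbb R^{n\times n}}\|\widehat H\|_1\quad\text{subject to}\quad a_i^\top\widehat H a_i=a_i^\top\nabla^2 f(x)\,a_i,\qquad i=1,\dots,M.$$ If $M\ge K_1 n r$, then with probability larger than $1-e^{-K_2M}$ this problem recovers $\nabla^2 f(x)$ exactly: $\nabla^2 f(x)$ is a solution, and it is the only symmetric solution. More precisely, every solution $\widehat H$ has symmetric part $\frac12(\widehat H+\widehat H^\top)=\nabla^2 f(x)$; hence $\widehat H=\nabla^2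 f(x)$ if $\widehat H$ is symmetric, and if $\nabla^2 f(x)$ is positive or negative semidefinite, then $\widehat H=\nabla^2 f(x)$ for every solution $\widehat H$. -/

import Mathlib

namespace HessianRecovery

/-- Euclidean space `ℝⁿ`. -/
abbrev E (n : ℕ) : Type := EuclideanSpace ℝ (Fin n)

/-- The Hessian matrix of `f` at `x`: its `(i, j)` entry is the second derivative of `f` at `x`
in the directions of the `i`-th and `j`-th standard basis vectors. -/
noncomputable def hessian {n : ℕ} (f : E n → ℝ) (x : E n) : Matrix (Fin n) (Fin n) ℝ :=
  Matrix.of fun i j =>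
    fderiv ℝ (fderiv ℝ f) x (EuclideanSpace.single i 1) (EuclideanSpace.single j 1)

/-- The spectral norm of a matrix (operator norm for the Euclidean norm). -/
noncomputable def spectralNorm {n : ℕ} (A : Matrix (Fin n) (Fin n) ℝ) : ℝ :=
  ‖Matrix.toEuclideanCLM (n := Fin n) (𝕜 := ℝ) A‖

/-- `f` is twice differentiable and its Hessian is `L`-Lipschitz in the spectral norm. -/
def HasLipschitzHessian {n : ℕ} (f : E n → ℝ) (L : ℝ) : Prop :=
  Differentiable ℝ f ∧ Differentiable ℝ (fderiv ℝ f) ∧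
    ∀ y z : E n, spectralNorm (hessian f y - hessian f z) ≤ L * ‖y - z‖

/-- The trace norm (nuclear norm) of a matrix: the sum of its singular values. -/
noncomputable def traceNorm {n : ℕ} (A : Matrix (Fin n) (Fin n) ℝ) : ℝ :=
  ∑ i : Fin n, (Matrix.toEuclideanLin A).singularValues i

/-- The quadratic measurement `aᵀ A a` of a matrix `A`. -/
def quadMeasurement {n : ℕ} (a : E n) (A : Matrix (Fin n) (Fin n) ℝ) : ℝ :=
  a.ofLp ⬝ᵥ A.mulVec a.ofLp

/-- The set of all real `n × n` matrices `A` with the measurements `aᵢᵀ A aᵢ = bᵢ`. -/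
def feasibleSet {n M : ℕ} (a : Fin M → E n) (b : Fin M → ℝ) : Set (Matrix (Fin n) (Fin n) ℝ) :=
  {A | ∀ i, quadMeasurement (a i) A = b i}

/-- `A` solves the trace-norm minimization problem
`min ‖A‖₁` over all real `n × n` matrices subject to `aᵢᵀ A aᵢ = bᵢ` for all `i`. -/
def IsSolution {n M : ℕ} (a : Fin M → E n) (b : Fin M → ℝ)
    (A : Matrix (Fin n) (Fin n) ℝ) : Prop :=
  A ∈ feasibleSet a b ∧ ∀ B ∈ feasibleSet a b, traceNorm A ≤ traceNorm B

end HessianRecovery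

/-! Write `X` for the Hessian, a symmetric matrix of rank `r`. The obstacle is that quadratic
measurements are not centred, so they are not directly a Frobenius isometry on low-rank matrices.
The cure is to pair the Gaussian vectors and rotate each pair `(x, y)` by `π/4`. The rotated pair
`(u, v)` is again independent standard Gaussian, and for symmetric `D` the number `⟨u, D v⟩` is, up
to sign, half the difference of the quadratic measurements of `D` at `x` and `y`
(`inner_rotation_eq_zero`, `hasLaw_rotated_pairs`). A symmetric `D` with vanishing quadratic
measurements is thus annihilated by centred bilinear ones.

Bilinear Gaussian measurements satisfy a mixed restricted isometry: their `ℓ¹`-norm is comparable to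
`N` times the Frobenius norm on all matrices of rank at most a fixed multiple of `r`. For one matrix
this is a Chernoff bound; a net of factorizations with exponentially many points makes it uniform
(`exists_restricted_isometry_event`).

The rest is deterministic. Split `D` into a tangent part `T` of rank at most `2r` and a part `G`
supported on the kernel of `X`. Either the sum of the matrix signs of `X` and `G` is a dual
certificate showing that `X + D` has larger trace norm, or the trace norm of `G` is at most `√r ‖T‖`
(`exists_tangent_decomposition`). In the second case, cutting the spectrum of `G` into blocks of
size `k`, a large multiple of `r`, contradicts the restricted isometry unless `D = 0`
(`exists_isContraction_of_restricted_isometry`).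

Certificates are kept symmetric because a symmetric `W` pairs equally with `B` and with its
symmetric part; this lets them bound nonsymmetric competitors (`recovery_of_isContraction`). -/

namespace HessianRecovery

open Matrix

/-! ### Duality between the trace norm and contractions -/

/-- The matrix `W` does not increase Euclidean norms. -/
def IsContraction {n : ℕ} (W : Matrix (Fin n) (Fin n) ℝ) : Prop :=
  ∀ x : E n, ‖Matrix.toEuclideanLin W x‖ ≤ ‖x‖

lemma trace_transpose_mul_eq_sum_inner {n : ℕ} (b : OrthonormalBasis (Fin n) ℝ (E n))
    (W A : Matrix (Fin n) (Fin n) ℝ) :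
    (Wᵀ * A).trace =
      ∑ i, inner ℝ (Matrix.toEuclideanLin W (b i)) (Matrix.toEuclideanLin A (b i)) := by
  have h1 : (Wᵀ * A).trace = LinearMap.trace ℝ (E n) (Matrix.toEuclideanLin (Wᵀ * A)) := by
    rw [Matrix.toEuclideanLin, Matrix.toLpLin_eq_toLin, Matrix.trace_toLin_eq]
  rw [h1, LinearMap.trace_eq_sum_inner _ b]
  refine Finset.sum_congr rfl fun i _ => ?_
  rw [← LinearMap.adjoint_inner_right, ← Matrix.toEuclideanLin_conjTranspose_eq_adjoint,
    Matrix.conjTranspose_eq_transpose_of_trivial]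
  congr 1
  ext j
  simp [Matrix.toLpLin_apply, Matrix.mulVec_mulVec]

/-- An eigenbasis of `AᵀA` consists of right singular vectors. It replaces a full singular value
decomposition throughout. -/
lemma exists_orthonormalBasis_traceNorm {n : ℕ} (A : Matrix (Fin n) (Fin n) ℝ) :
    ∃ b : OrthonormalBasis (Fin n) ℝ (E n),
      (∀ i j, i ≠ j →
        inner ℝ (Matrix.toEuclideanLin A (b i)) (Matrix.toEuclideanLin A (b j)) = (0 : ℝ)) ∧
      traceNorm A = ∑ i, ‖Matrix.toEuclideanLin A (b i)‖ := by
  set T := Matrix.toEuclideanLin A with hT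
  have hn : Module.finrank ℝ (E n) = n := by simp
  set hS := T.isSymmetric_adjoint_comp_self
  set b := hS.eigenvectorBasis hn
  have hij : ∀ i j, inner ℝ (T (b i)) (T (b j)) =
      hS.eigenvalues hn j * inner ℝ (b i) (b j) := by
    intro i j
    rw [← LinearMap.adjoint_inner_right]
    have := hS.apply_eigenvectorBasis hn j
    rw [LinearMap.comp_apply] at this
    rw [this]
    simp [b, inner_smul_right]
  refine ⟨b, fun i j h => ?_, ?_⟩
  · rw [hij, b.inner_eq_zero h, mul_zero]
  · refine Finset.sum_congr rfl fun i _ => ?_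
    rw [T.singularValues_fin hn i, norm_eq_sqrt_real_inner, hij]
    simp

theorem trace_le_traceNorm {n : ℕ} {W : Matrix (Fin n) (Fin n) ℝ} (hW : IsContraction W)
    (A : Matrix (Fin n) (Fin n) ℝ) : (Wᵀ * A).trace ≤ traceNorm A := by
  obtain ⟨b, -, hb⟩ := exists_orthonormalBasis_traceNorm A
  rw [trace_transpose_mul_eq_sum_inner b, hb]
  refine Finset.sum_le_sum fun i _ => (real_inner_le_norm _ _).trans ?_
  have := hW (b i)
  rw [b.norm_eq_one] at this
  exact mul_le_of_le_one_left (norm_nonneg _) this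

/-- The witness is the polar part of `A`: it sends each right singular vector to the normalized
image under `A`, and to `0` where that image vanishes. The images are orthogonal of norm at most
`1`, hence a contraction. -/
theorem exists_isContraction_trace_eq_traceNorm {n : ℕ} (A : Matrix (Fin n) (Fin n) ℝ) :
    ∃ W, IsContraction W ∧ (Wᵀ * A).trace = traceNorm A := by
  obtain ⟨b, hb0, hb⟩ := exists_orthonormalBasis_traceNorm A
  set T := Matrix.toEuclideanLin A with hT
  set f : Fin n → E n := fun i => ‖T (b i)‖⁻¹ • T (b i) with hf
  have hff : ∀ i j, i ≠ j → inner ℝ (f i) (f j) = (0 : ℝ) := by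
    intro i j h
    simp [hf, inner_smul_left, inner_smul_right, hb0 i j h]
  have hfn : ∀ i, ‖f i‖ ≤ 1 := by
    intro i
    simp only [hf, norm_smul, norm_inv, norm_norm]
    exact inv_mul_le_one
  set Wl : E n →ₗ[ℝ] E n := ∑ i, (innerₛₗ ℝ (b i)).smulRight (f i) with hWl
  have hWx : ∀ x, Wl x = ∑ i, inner ℝ (b i) x • f i := by
    intro x
    simp [hWl, LinearMap.sum_apply]
  refine ⟨Matrix.toEuclideanLin.symm Wl, ?_, ?_⟩
  · intro x
    rw [LinearEquiv.apply_symm_apply, hWx]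
    refine le_of_sq_le_sq ?_ (norm_nonneg _)
    rw [← real_inner_self_eq_norm_sq, sum_inner, ← b.sum_sq_norm_inner_right x]
    refine Finset.sum_le_sum fun i _ => ?_
    rw [inner_sum, Finset.sum_eq_single i]
    · simp only [inner_smul_left, inner_smul_right, real_inner_self_eq_norm_sq, Real.norm_eq_abs,
        sq_abs]
      have := hfn i
      have h2 : ‖f i‖ ^ 2 ≤ 1 := by nlinarith [norm_nonneg (f i)]
      simp only [conj_trivial]
      nlinarith [sq_nonneg (inner ℝ (b i) x)]
    · intro j _ hj
      simp [inner_smul_left, inner_smul_right, hff i j hj.symm]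
    · simp
  · rw [trace_transpose_mul_eq_sum_inner b, hb]
    refine Finset.sum_congr rfl fun i _ => ?_
    rw [LinearEquiv.apply_symm_apply, hWx, Finset.sum_eq_single i]
    · simp only [real_inner_self_eq_norm_sq, b.norm_eq_one, hf, ← hT, inner_smul_left]
      rcases eq_or_ne ‖T (b i)‖ 0 with h | h
      · simp [h]
      · simp; field_simp
    · intro j _ hj
      simp [b.inner_eq_zero hj]
    · simp

lemma IsContraction.neg {n : ℕ} {W : Matrix (Fin n) (Fin n) ℝ} (hW : IsContraction W) :
    IsContraction (-W) := fun x => by simpa using hW x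

lemma traceNorm_neg_le {n : ℕ} (A : Matrix (Fin n) (Fin n) ℝ) : traceNorm (-A) ≤ traceNorm A := by
  obtain ⟨W, hW, h⟩ := exists_isContraction_trace_eq_traceNorm (-A)
  rw [← h]
  simpa using trace_le_traceNorm hW.neg A

/-- A matrix whose trace attains its trace norm is symmetric. -/
theorem isSymm_of_traceNorm_le_trace {n : ℕ} {H : Matrix (Fin n) (Fin n) ℝ}
    (h : traceNorm H ≤ H.trace) : H.IsSymm := by
  obtain ⟨b, -, hb⟩ := exists_orthonormalBasis_traceNorm H
  have htr : H.trace = ∑ i, inner ℝ (b i) (Matrix.toEuclideanLin H (b i)) := by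
    have := trace_transpose_mul_eq_sum_inner b 1 H
    simpa using this
  set T := Matrix.toEuclideanLin H with hT
  have hle : ∀ i ∈ Finset.univ, inner ℝ (b i) (T (b i)) ≤ ‖T (b i)‖ := fun i _ => by
    simpa [b.norm_eq_one] using real_inner_le_norm (b i) (T (b i))
  -- Equality of the two sums forces equality in each Cauchy–Schwarz inequality, so `T` is diagonal
  -- in the orthonormal basis `b`.
  have heq : ∀ i, T (b i) = ‖T (b i)‖ • b i := by
    intro i
    have h1 : ∑ i, inner ℝ (b i) (T (b i)) = ∑ i, ‖T (b i)‖ :=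
      le_antisymm (Finset.sum_le_sum hle) (by rw [← hb, ← htr]; exact h)
    have h2 := (Finset.sum_eq_sum_iff_of_le hle).1 h1 i (Finset.mem_univ _)
    have h3 : inner ℝ (b i) (T (b i)) = ‖b i‖ * ‖T (b i)‖ := by rw [h2, b.norm_eq_one, one_mul]
    have h4 := inner_eq_norm_mul_iff_real.1 h3
    rw [b.norm_eq_one, one_smul] at h4
    exact h4.symm
  have hadj : LinearMap.adjoint T = T := by
    refine b.toBasis.ext fun i => InnerProductSpace.ext_inner_left_basis b.toBasis fun j => ?_
    simp only [OrthonormalBasis.coe_toBasis, LinearMap.adjoint_inner_right]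
    rw [heq i, heq j, inner_smul_left, inner_smul_right]
    rcases eq_or_ne j i with rfl | hji
    · simp
    · simp [b.inner_eq_zero hji]
  rw [hT, ← Matrix.toEuclideanLin_conjTranspose_eq_adjoint,
    Matrix.conjTranspose_eq_transpose_of_trivial] at hadj
  exact Matrix.toEuclideanLin.injective hadj

lemma traceNorm_le_sum_norm {n : ℕ} (A : Matrix (Fin n) (Fin n) ℝ)
    (b : OrthonormalBasis (Fin n) ℝ (E n)) :
    traceNorm A ≤ ∑ i, ‖Matrix.toEuclideanLin A (b i)‖ := by
  obtain ⟨W, hW, h⟩ := exists_isContraction_trace_eq_traceNorm A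
  rw [← h, trace_transpose_mul_eq_sum_inner b]
  refine Finset.sum_le_sum fun i _ => (real_inner_le_norm _ _).trans ?_
  have := hW (b i)
  rw [b.norm_eq_one] at this
  exact mul_le_of_le_one_left (norm_nonneg _) this

/-! ### Spectral decomposition, Frobenius norm and matrix signs -/

lemma exists_spectral_decomposition {n : ℕ} {A : Matrix (Fin n) (Fin n) ℝ} (hA : A.IsSymm) :
    ∃ (U : Matrix (Fin n) (Fin n) ℝ) (w : Fin n → ℝ), Uᵀ * U = 1 ∧ U * Uᵀ = 1 ∧
      A = U * Matrix.diagonal w * Uᵀ ∧ traceNorm A ≤ ∑ i, |w i| := by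
  have hH : A.IsHermitian := by
    rw [Matrix.IsHermitian, Matrix.conjTranspose_eq_transpose_of_trivial]; exact hA
  have hU := hH.eigenvectorUnitary.2
  rw [Matrix.mem_unitaryGroup_iff, Matrix.star_eq_conjTranspose,
    Matrix.conjTranspose_eq_transpose_of_trivial] at hU
  refine ⟨hH.eigenvectorUnitary, hH.eigenvalues, mul_eq_one_comm.1 hU, hU, ?_, ?_⟩
  · have := hH.spectral_theorem
    simpa [Unitary.conjStarAlgAut_apply, Matrix.star_eq_conjTranspose] using this
  · refine (traceNorm_le_sum_norm A hH.eigenvectorBasis).trans (Finset.sum_le_sum fun i _ => ?_)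
    rw [Matrix.toLpLin_apply, hH.mulVec_eigenvectorBasis, WithLp.toLp_smul, norm_smul]
    simp

/-- Here `‖Wx‖² = ⟨x, W²x⟩ ≤ ‖x‖ ‖W²x‖`, and `W³ = W` gives `‖W²x‖ = ‖Wx‖`. Matrix signs satisfy
this identity, and so do sums of signs with orthogonal supports. -/
lemma isContraction_of_mul_self_mul_self {n : ℕ} {W : Matrix (Fin n) (Fin n) ℝ} (hs : Wᵀ = W)
    (h : W * W * W = W) : IsContraction W := by
  have hadj : LinearMap.adjoint (Matrix.toEuclideanLin W) = Matrix.toEuclideanLin W := by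
    rw [← Matrix.toEuclideanLin_conjTranspose_eq_adjoint,
      Matrix.conjTranspose_eq_transpose_of_trivial, hs]
  set T := Matrix.toEuclideanLin W with hT
  have hTT : ∀ x, T (T (T x)) = T x := by
    intro x
    conv_rhs => rw [hT, ← h]
    ext j
    simp [hT, Matrix.toLpLin_apply, Matrix.mulVec_mulVec, mul_assoc]
  have hin : ∀ x y, inner ℝ (T x) y = inner ℝ x (T y) := by
    intro x y
    conv_lhs => rw [← hadj]
    rw [LinearMap.adjoint_inner_left]
  intro x
  have h1 : ‖T x‖ ^ 2 = inner ℝ x (T (T x)) := by rw [← real_inner_self_eq_norm_sq, hin]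
  have h2 : ‖T (T x)‖ ^ 2 = ‖T x‖ ^ 2 := by
    rw [← real_inner_self_eq_norm_sq, ← real_inner_self_eq_norm_sq, hin, hTT, hin]
  have h3 := real_inner_le_norm x (T (T x))
  rw [← h1, ← h2] at h3
  have h4 : ‖T (T x)‖ = ‖T x‖ := by
    exact (sq_eq_sq₀ (norm_nonneg _) (norm_nonneg _)).1 h2
  rw [h4] at h3
  rcases (norm_nonneg (T x)).eq_or_lt with h5 | h5
  · rw [← h5]; exact norm_nonneg _
  · exact le_of_mul_le_mul_right (by nlinarith) h5

/-- The squared Frobenius norm. -/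
def frobSq {n : ℕ} (A : Matrix (Fin n) (Fin n) ℝ) : ℝ := (Aᵀ * A).trace

lemma frobSq_eq_sum {n : ℕ} (A : Matrix (Fin n) (Fin n) ℝ) :
    frobSq A = ∑ j, ∑ i, A i j ^ 2 := by
  simp [frobSq, Matrix.trace, Matrix.mul_apply, pow_two]

lemma frobSq_nonneg {n : ℕ} (A : Matrix (Fin n) (Fin n) ℝ) : 0 ≤ frobSq A := by
  rw [frobSq_eq_sum]; positivity

lemma eq_zero_of_frobSq_le_zero {n : ℕ} {A : Matrix (Fin n) (Fin n) ℝ} (h : frobSq A ≤ 0) :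
    A = 0 := by
  have h1 := le_antisymm h (frobSq_nonneg A)
  rw [frobSq, ← Matrix.conjTranspose_eq_transpose_of_trivial] at h1
  exact Matrix.trace_conjTranspose_mul_self_eq_zero_iff.1 h1

lemma trace_transpose_mul_sq_le {n : ℕ} (A B : Matrix (Fin n) (Fin n) ℝ) :
    (Aᵀ * B).trace ^ 2 ≤ frobSq A * frobSq B := by
  have h := Finset.sum_mul_sq_le_sq_mul_sq (Finset.univ : Finset (Fin n × Fin n))
    (fun p => A p.2 p.1) (fun p => B p.2 p.1)
  simp only [Fintype.sum_prod_type] at h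
  rw [frobSq_eq_sum, frobSq_eq_sum]
  simpa [Matrix.trace, Matrix.mul_apply] using h

lemma frobSq_add {n : ℕ} (A B : Matrix (Fin n) (Fin n) ℝ) :
    frobSq (A + B) = frobSq A + frobSq B + 2 * (Aᵀ * B).trace := by
  have h : (Bᵀ * A).trace = (Aᵀ * B).trace := by
    rw [← Matrix.trace_transpose, Matrix.transpose_mul, Matrix.transpose_transpose]
  simp only [frobSq, Matrix.transpose_add, add_mul, mul_add, Matrix.trace_add, h]
  ring

lemma matrix_rank_add_le {n : ℕ} (A B : Matrix (Fin n) (Fin n) ℝ) :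
    (A + B).rank ≤ A.rank + B.rank := by
  rw [Matrix.rank, Matrix.rank, Matrix.rank, Matrix.mulVecLin_add]
  refine (Submodule.finrank_mono ?_).trans (Submodule.finrank_add_le_finrank_add_finrank _ _)
  rintro _ ⟨x, rfl⟩
  exact Submodule.add_mem_sup ⟨x, rfl⟩ ⟨x, rfl⟩

section Conjugation

variable {n : ℕ} {U : Matrix (Fin n) (Fin n) ℝ}

lemma conj_diagonal_mul (hU : Uᵀ * U = 1) (d e : Fin n → ℝ) :
    (U * Matrix.diagonal d * Uᵀ) * (U * Matrix.diagonal e * Uᵀ) =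
      U * Matrix.diagonal (fun i => d i * e i) * Uᵀ := by
  calc _ = U * Matrix.diagonal d * (Uᵀ * U) * Matrix.diagonal e * Uᵀ := by
        simp only [mul_assoc]
    _ = _ := by rw [hU, mul_one, mul_assoc U, Matrix.diagonal_mul_diagonal]

lemma trace_conj_diagonal (hU : Uᵀ * U = 1) (d : Fin n → ℝ) :
    (U * Matrix.diagonal d * Uᵀ).trace = ∑ i, d i := by
  rw [Matrix.trace_mul_comm, ← mul_assoc, hU, one_mul, Matrix.trace_diagonal]

lemma transpose_conj_diagonal (U : Matrix (Fin n) (Fin n) ℝ) (d : Fin n → ℝ) :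
    (U * Matrix.diagonal d * Uᵀ)ᵀ = U * Matrix.diagonal d * Uᵀ := by
  simp [mul_assoc]

lemma frobSq_conj_diagonal (hU : Uᵀ * U = 1) (d : Fin n → ℝ) :
    frobSq (U * Matrix.diagonal d * Uᵀ) = ∑ i, d i ^ 2 := by
  rw [frobSq, transpose_conj_diagonal, conj_diagonal_mul hU, trace_conj_diagonal hU]
  simp [pow_two]

lemma rank_conj_diagonal_le (U : Matrix (Fin n) (Fin n) ℝ) (d : Fin n → ℝ) :
    (U * Matrix.diagonal d * Uᵀ).rank ≤ (Finset.univ.filter fun i => d i ≠ 0).card := by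
  refine (Matrix.rank_mul_le_left _ _).trans ((Matrix.rank_mul_le_right _ _).trans ?_)
  rw [Matrix.rank_diagonal, Fintype.card_subtype]

lemma rank_conj_diagonal (hU : Uᵀ * U = 1) (d : Fin n → ℝ) :
    (U * Matrix.diagonal d * Uᵀ).rank = (Finset.univ.filter fun i => d i ≠ 0).card := by
  refine le_antisymm (rank_conj_diagonal_le U d) ?_
  have h : Matrix.diagonal d = Uᵀ * (U * Matrix.diagonal d * Uᵀ) * U := by
    calc _ = (Uᵀ * U) * Matrix.diagonal d * (Uᵀ * U) := by rw [hU, one_mul, mul_one]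
      _ = _ := by simp only [mul_assoc]
  rw [← Fintype.card_subtype, ← Matrix.rank_diagonal]
  conv_lhs => rw [h]
  exact (Matrix.rank_mul_le_left _ _).trans (Matrix.rank_mul_le_right _ _)

end Conjugation

/-- The matrix sign of a symmetric matrix. -/
lemma exists_sign {n : ℕ} {A : Matrix (Fin n) (Fin n) ℝ} (hA : A.IsSymm) :
    ∃ (U : Matrix (Fin n) (Fin n) ℝ) (w : Fin n → ℝ) (S Z : Matrix (Fin n) (Fin n) ℝ),
      Uᵀ * U = 1 ∧ A = U * Matrix.diagonal w * Uᵀ ∧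
      Sᵀ = S ∧ S * S * S = S ∧ S = A * Z ∧ S = Z * A ∧ S * S * A = A ∧ A * (S * S) = A ∧
      (S * A).trace = ∑ i, |w i| ∧ traceNorm A ≤ ∑ i, |w i| ∧ frobSq S = A.rank := by
  obtain ⟨U, w, hU, -, hAU, htr⟩ := exists_spectral_decomposition hA
  set s : Fin n → ℝ := fun i => (SignType.sign (w i) : ℝ) with hs
  have hss : ∀ i, s i * s i * s i = s i := by
    intro i
    rcases lt_trichotomy (w i) 0 with h | h | h <;> simp [hs, h]
  have hsw : ∀ i, s i * s i * w i = w i := by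
    intro i
    rcases lt_trichotomy (w i) 0 with h | h | h <;> simp [hs, h]
  refine ⟨U, w, U * Matrix.diagonal s * Uᵀ, U * Matrix.diagonal (fun i => |w i|⁻¹) * Uᵀ, hU, hAU,
    transpose_conj_diagonal _ _, ?_, ?_, ?_, ?_, ?_, ?_, htr, ?_⟩
  · simp only [conj_diagonal_mul hU, hss]
  · rw [hAU, conj_diagonal_mul hU]
    congr 3
    ext i
    rcases lt_trichotomy (w i) 0 with h | h | h
    · simp [hs, h, abs_of_neg, h.ne]
    · simp [hs, h]
    · simp [hs, h, abs_of_pos, h.ne']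
  · rw [hAU, conj_diagonal_mul hU]
    congr 3
    ext i
    rcases lt_trichotomy (w i) 0 with h | h | h
    · simp [hs, h, abs_of_neg, h.ne]
    · simp [hs, h]
    · simp [hs, h, abs_of_pos, h.ne']
  · rw [hAU]; simp only [conj_diagonal_mul hU, hsw]
  · rw [hAU]; simp only [conj_diagonal_mul hU, mul_comm (w _), hsw]
  · rw [hAU, conj_diagonal_mul hU, trace_conj_diagonal hU]
    refine Finset.sum_congr rfl fun i _ => ?_
    rcases lt_trichotomy (w i) 0 with h | h | h
    · simp [hs, h, abs_of_neg]
    · simp [hs, h]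
    · simp [hs, h, abs_of_pos]
  · rw [frobSq_conj_diagonal hU, hAU, rank_conj_diagonal hU, Finset.card_filter]
    push_cast
    refine Finset.sum_congr rfl fun i _ => ?_
    rcases lt_trichotomy (w i) 0 with h | h | h
    · simp [hs, h, h.ne]
    · simp [hs, h]
    · simp [hs, h, h.ne']

theorem exists_isContraction_traceNorm_le {n : ℕ} {X : Matrix (Fin n) (Fin n) ℝ}
    (hX : X.IsSymm) : ∃ W, IsContraction W ∧ Wᵀ = W ∧ traceNorm X ≤ (W * X).trace := by
  obtain ⟨U, w, S, Z, -, -, hS, hS3, -, -, -, -, htr, hle, -⟩ := exists_sign hX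
  exact ⟨S, isContraction_of_mul_self_mul_self hS hS3, hS, by rw [htr]; exact hle⟩

/-! ### Dual certificates and the tangent decomposition -/

/-- Decomposition of a symmetric perturbation `D` of a symmetric matrix `X` into a part
`U diag(w) Uᵀ` orthogonal to the row and column space of `X` and a part of rank at most
`2 rank X`: either a symmetric contraction certifies that `X + D` has larger trace norm than
`X`, or the orthogonal part is controlled by the low-rank part. -/
theorem exists_tangent_decomposition {n : ℕ} {X D : Matrix (Fin n) (Fin n) ℝ}
    (hX : X.IsSymm) (hD : D.IsSymm) :
    ∃ (U T : Matrix (Fin n) (Fin n) ℝ) (w : Fin n → ℝ), Uᵀ * U = 1 ∧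
      D = T + U * Matrix.diagonal w * Uᵀ ∧ T.rank ≤ 2 * X.rank ∧
      (∀ d : Fin n → ℝ,
        frobSq T ≤ frobSq (T + U * Matrix.diagonal (fun i => w i * d i) * Uᵀ)) ∧
      ((∃ W, IsContraction W ∧ Wᵀ = W ∧ traceNorm X < (W * (X + D)).trace) ∨
        ∑ i, |w i| ≤ √X.rank * √(frobSq T)) := by
  obtain ⟨-, wX, S, Z, -, -, hS, hS3, hSZ, -, hSX, hXS, htrX, hleX, hfro⟩ := exists_sign hX
  set P := S * S with hP
  set Q := 1 - P with hQ
  have hPt : Pᵀ = P := by rw [hP, Matrix.transpose_mul, hS]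
  have hQt : Qᵀ = Q := by rw [hQ, Matrix.transpose_sub, hPt, Matrix.transpose_one]
  have hPP : P * P = P := by rw [hP, ← mul_assoc, hS3]
  have hQQ : Q * Q = Q := by rw [hQ, mul_sub, mul_one, sub_mul, one_mul, hPP]; abel
  have hSQ : S * Q = 0 := by rw [hQ, mul_sub, mul_one, hP, ← mul_assoc, hS3, sub_self]
  have hQS : Q * S = 0 := by rw [hQ, sub_mul, one_mul, hP, hS3, sub_self]
  have hGs : (Q * D * Q).IsSymm := by
    rw [Matrix.IsSymm, Matrix.transpose_mul, Matrix.transpose_mul, hQt, hD.eq, mul_assoc]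
  obtain ⟨U, w, S', Z', hU, hGU, hS', hS3', hSZ', hZS', -, -, htrG, -, -⟩ := exists_sign hGs
  set G := Q * D * Q with hG
  have hQG : Q * G = G := by rw [hG, ← mul_assoc, ← mul_assoc, hQQ]
  have hGQ : G * Q = G := by rw [hG, mul_assoc, hQQ]
  have hQS' : Q * S' = S' := by rw [hSZ', ← mul_assoc, hQG]
  have hS'Q : S' * Q = S' := by rw [hZS', mul_assoc, hGQ]
  have hSS' : S * S' = 0 := by rw [← hQS', ← mul_assoc, hSQ, zero_mul]
  have hS'S : S' * S = 0 := by rw [← hS'Q, mul_assoc, hQS, mul_zero]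
  have hQTQ : Q * (D - G) * Q = 0 := by
    rw [mul_sub Q, sub_mul, hQG, hGQ, hG, sub_self]
  refine ⟨U, D - G, w, hU, by rw [← hGU]; abel, ?_, ?_, ?_⟩
  -- Each summand contains the projection `P` onto the range of `X` as a factor, so has rank at most
  -- that of `X`.
  · have h1 : D - G = P * D + (1 - P) * D * P := by rw [hG, hQ]; noncomm_ring
    have hPr : P.rank ≤ X.rank := by
      rw [hP]
      refine (Matrix.rank_mul_le_left _ _).trans ?_
      rw [hSZ]
      exact Matrix.rank_mul_le_left _ _
    rw [h1, two_mul]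
    exact (matrix_rank_add_le _ _).trans (add_le_add
      ((Matrix.rank_mul_le_left _ _).trans hPr) ((Matrix.rank_mul_le_right _ _).trans hPr))
  · intro d
    set B := U * Matrix.diagonal (fun i => w i * d i) * Uᵀ with hB
    -- Coefficients of the form `w i * d i` are what make `B` a multiple of `G` on both sides, hence
    -- `QBQ = B`; a null vector of `G` need not lie in the range of `Q`. Since `Q(D - G)Q = 0`, the
    -- two parts are Frobenius-orthogonal.
    have hB1 : B = G * (U * Matrix.diagonal d * Uᵀ) := by rw [hGU, conj_diagonal_mul hU]
    have hB2 : B = (U * Matrix.diagonal d * Uᵀ) * G := by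
      rw [hGU, conj_diagonal_mul hU, hB]; simp only [mul_comm]
    have hQB : Q * B = B := by rw [hB1, ← mul_assoc, hQG]
    have hBQ : B * Q = B := by rw [hB2, mul_assoc, hGQ]
    have hTt : (D - G)ᵀ = D - G := by rw [Matrix.transpose_sub, hD.eq, hGs.eq]
    have h0 : ((D - G)ᵀ * B).trace = 0 := by
      calc _ = ((D - G) * (Q * B * Q)).trace := by rw [hTt, hQB, hBQ]
        _ = ((D - G) * Q * B * Q).trace := by simp only [mul_assoc]
        _ = (Q * (D - G) * Q * B).trace := by
            rw [Matrix.trace_mul_comm]; simp only [mul_assoc]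
        _ = 0 := by rw [hQTQ, zero_mul, Matrix.trace_zero]
    rw [frobSq_add, h0]
    have := frobSq_nonneg B
    linarith
  · by_cases hlt : ∑ i, |w i| ≤ √X.rank * √(frobSq (D - G))
    · exact Or.inr hlt
    refine Or.inl ⟨S + S', ?_, by rw [Matrix.transpose_add, hS, hS'], ?_⟩
    · refine isContraction_of_mul_self_mul_self (by rw [Matrix.transpose_add, hS, hS']) ?_
      -- The signs of `X` and `G` annihilate each other, so the cube of the sum is again the sum.
      have : (S + S') * (S + S') = S * S + S' * S' := by
        rw [add_mul, mul_add, mul_add, hSS', hS'S]; abel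
      rw [this, add_mul, mul_add, mul_add, hS3, hS3', mul_assoc S, hSS', mul_assoc S', hS'S]
      simp
    · push Not at hlt
      have hS'X : S' * X = 0 := by
        rw [← hSX, hP, ← mul_assoc, ← mul_assoc, hS'S, zero_mul, zero_mul]
      have h1 : (S' * D).trace = ∑ i, |w i| := by
        rw [← htrG, hG]
        calc (S' * D).trace = (Q * S' * Q * D).trace := by rw [hQS', hS'Q]
          _ = (S' * (Q * D * Q)).trace := by
            rw [mul_assoc, mul_assoc, Matrix.trace_mul_comm]; simp only [mul_assoc]
      have h2 : (S * D).trace = (S * (D - G)).trace := by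
        rw [mul_sub, Matrix.trace_sub, hG, ← mul_assoc, ← mul_assoc, hSQ]
        simp
      have h3 : -(√X.rank * √(frobSq (D - G))) ≤ (S * (D - G)).trace := by
        have h4 := trace_transpose_mul_sq_le S (D - G)
        rw [hS, hfro] at h4
        rw [← Real.sqrt_mul (by positivity)]
        exact (abs_le.1 (Real.abs_le_sqrt h4)).1
      rw [add_mul, mul_add, mul_add, Matrix.trace_add, Matrix.trace_add, Matrix.trace_add, hS'X, h1,
        h2, htrX, Matrix.trace_zero]
      linarith

/-! ### Block decomposition of vectors -/

lemma exists_top_subset {ι : Type*} [DecidableEq ι] (f : ι → ℝ) (J : Finset ι) (k : ℕ)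
    (hk : k ≤ J.card) : ∃ S ⊆ J, S.card = k ∧ ∀ i ∈ S, ∀ j ∈ J \ S, f j ≤ f i := by
  induction k with
  | zero => exact ⟨∅, Finset.empty_subset _, rfl, by simp⟩
  | succ k ih =>
    obtain ⟨S, hSJ, hSk, hS⟩ := ih (by omega)
    have hne : (J \ S).Nonempty := by
      rw [← Finset.card_pos, Finset.card_sdiff_of_subset hSJ]; omega
    obtain ⟨m, hm, hmax⟩ := Finset.exists_max_image _ f hne
    have hm' := Finset.mem_sdiff.1 hm
    refine ⟨insert m S, Finset.insert_subset hm'.1 hSJ, ?_, ?_⟩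
    · rw [Finset.card_insert_of_notMem hm'.2, hSk]
    · intro i hi j hj
      simp only [Finset.mem_sdiff, Finset.mem_insert, not_or] at hj
      rcases Finset.mem_insert.1 hi with rfl | hi
      · exact hmax j (Finset.mem_sdiff.2 ⟨hj.1, hj.2.2⟩)
      · exact hS i hi j (Finset.mem_sdiff.2 ⟨hj.1, hj.2.2⟩)

lemma le_average_of_top {ι : Type*} {f : ι → ℝ} {S : Finset ι} {k : ℕ} (hk : 0 < k)
    (hS : S.card = k) {t : ℝ} (h : ∀ i ∈ S, t ≤ f i) : t ≤ (∑ i ∈ S, f i) / k := by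
  rw [le_div_iff₀ (by exact_mod_cast hk)]
  have := Finset.card_nsmul_le_sum S f t h
  rw [hS, nsmul_eq_mul] at this
  linarith

lemma sqrt_mul_div (k x : ℝ) : √k * (x / k) = x / √k := by
  rw [mul_div_left_comm, Real.sqrt_div_self, div_eq_mul_inv x]

/-- A subadditive function dominated by a multiple of the `ℓ²`-norm on `k`-sparse vectors is
dominated by a combination of the `ℓ∞`- and `ℓ¹`-norms on all vectors. -/
lemma le_of_le_on_sparse {ι : Type*} [Fintype ι] [DecidableEq ι] {Ψ : (ι → ℝ) → ℝ} {C : ℝ}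
    (hC : 0 ≤ C) {k : ℕ} (hk : 0 < k) (hadd : ∀ d e, Ψ (d + e) ≤ Ψ d + Ψ e)
    (hsp : ∀ d : ι → ℝ, (Finset.univ.filter fun i => d i ≠ 0).card ≤ k →
      Ψ d ≤ C * √(∑ i, d i ^ 2))
    (J : Finset ι) (d : ι → ℝ) (τ : ℝ) (hτ : 0 ≤ τ) (hd : ∀ i, |d i| ≤ τ) (hJ : ∀ i ∉ J, d i = 0) :
    Ψ d ≤ C * (√k * τ + (∑ i, |d i|) / √k) := by
  have hk' : (0 : ℝ) < √k := Real.sqrt_pos.2 (by exact_mod_cast hk)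
  have key : ∀ (τ : ℝ), 0 ≤ τ → ∀ (S : Finset ι) (e : ι → ℝ), S.card ≤ k → (∀ i, |e i| ≤ τ) →
      (∀ i ∉ S, e i = 0) → Ψ e ≤ C * (√k * τ) := by
    intro τ hτ S e hS he h0
    have hsub : (Finset.univ.filter fun i => e i ≠ 0) ⊆ S := by
      intro i hi
      by_contra h
      exact (Finset.mem_filter.1 hi).2 (h0 i h)
    refine (hsp e ((Finset.card_le_card hsub).trans hS)).trans
      (mul_le_mul_of_nonneg_left ?_ hC)
    rw [← Real.sqrt_sq hτ, ← Real.sqrt_mul (by positivity)]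
    refine Real.sqrt_le_sqrt ?_
    rw [← Finset.sum_subset (Finset.subset_univ S) (fun i _ hi => by simp [h0 i hi])]
    calc ∑ i ∈ S, e i ^ 2 ≤ ∑ i ∈ S, τ ^ 2 := Finset.sum_le_sum fun i _ => by
          rw [← sq_abs]; exact pow_le_pow_left₀ (abs_nonneg _) (he i) 2
      _ = S.card * τ ^ 2 := by simp
      _ ≤ k * τ ^ 2 := by gcongr
  -- Peel off the `k` largest entries. That block costs `√k τ`, and every remaining entry is at most
  -- the block average `τ'`. Since `√k τ'` is the block's `ℓ¹`-mass over `√k`, the costs telescope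
  -- into the total `ℓ¹`-norm.
  induction hJc : J.card using Nat.strong_induction_on generalizing J d τ with
  | _ N ih =>
    rcases le_or_gt J.card k with hle | hgt
    · refine (key τ hτ J d hle hd hJ).trans (mul_le_mul_of_nonneg_left ?_ hC)
      have : 0 ≤ (∑ i, |d i|) / √k := by positivity
      linarith
    · obtain ⟨S, hSJ, hSk, hS⟩ := exists_top_subset (fun i => |d i|) J k hgt.le
      set e : ι → ℝ := fun i => if i ∈ S then d i else 0 with he
      set e' : ι → ℝ := fun i => if i ∈ S then 0 else d i with he'
      have hde : d = e + e' := by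
        ext i; by_cases h : i ∈ S <;> simp [he, he', h]
      set τ' : ℝ := (∑ i ∈ S, |d i|) / k with hτ'
      have hτ'0 : 0 ≤ τ' := by positivity
      have h1 : Ψ e ≤ C * (√k * τ) := by
        refine key τ hτ S e hSk.le (fun i => ?_) (fun i hi => by simp [he, hi])
        by_cases h : i ∈ S <;> simp [he, h, hd i, hτ]
      have h2 : Ψ e' ≤ C * (√k * τ' + (∑ i, |e' i|) / √k) := by
        refine ih (J \ S).card ?_ (J \ S) e' τ' hτ'0 ?_ ?_ rfl
        · rw [← hJc]
          exact Finset.card_lt_card (Finset.sdiff_ssubset hSJ (Finset.card_pos.1 (by omega)))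
        · intro i
          by_cases hi : i ∈ S
          · simp [he', hi, hτ'0]
          · by_cases hiJ : i ∈ J
            · simp only [he', hi, if_false]
              exact le_average_of_top hk hSk
                fun j hj => hS j hj i (Finset.mem_sdiff.2 ⟨hiJ, hi⟩)
            · simp [he', hi, hJ i hiJ, hτ'0]
        · intro i hi
          by_cases hiS : i ∈ S
          · simp [he', hiS]
          · have : i ∉ J := fun h => hi (Finset.mem_sdiff.2 ⟨h, hiS⟩)
            simp [he', hiS, hJ i this]
      have h3 : √k * τ' = (∑ i ∈ S, |d i|) / √k := by
        rw [hτ', sqrt_mul_div]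
      have h4 : ∑ i, |d i| = ∑ i ∈ S, |d i| + ∑ i, |e' i| := by
        have : ∑ i ∈ S, |d i| = ∑ i, |e i| := by
          rw [← Finset.sum_subset (Finset.subset_univ S) (fun i _ hi => by simp [he, hi])]
          exact Finset.sum_congr rfl fun i hi => by simp [he, hi]
        rw [this, ← Finset.sum_add_distrib]
        refine Finset.sum_congr rfl fun i _ => ?_
        by_cases h : i ∈ S <;> simp [he, he', h]
      calc Ψ d ≤ Ψ e + Ψ e' := by rw [hde]; exact hadd _ _
        _ ≤ C * (√k * τ) + C * (√k * τ' + (∑ i, |e' i|) / √k) := add_le_add h1 h2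
        _ = C * (√k * τ + (∑ i, |d i|) / √k) := by rw [h3, h4]; ring

/-! ### From restricted isometry to exact recovery -/

/-- If a seminorm `Φ` is equivalent to the Frobenius norm on low-rank matrices and vanishes at a
symmetric `D ≠ 0`, then `X + D` has larger trace norm than `X`, and this is certified by a
symmetric contraction. -/
theorem exists_isContraction_of_restricted_isometry {n : ℕ} {X D : Matrix (Fin n) (Fin n) ℝ}
    (hX : X.IsSymm) (hD : D.IsSymm) (hD0 : D ≠ 0) {Φ : Matrix (Fin n) (Fin n) ℝ → ℝ}
    {c C : ℝ} {k : ℕ} (hC : 0 ≤ C) (hk : 0 < k)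
    (hadd : ∀ A B, Φ (A + B) ≤ Φ A + Φ B) (hneg : ∀ A, Φ (-A) = Φ A)
    (hlow : ∀ A, A.rank ≤ 2 * X.rank + k → c * √(frobSq A) ≤ Φ A)
    (hup : ∀ A, A.rank ≤ k → Φ A ≤ C * √(frobSq A))
    (hkr : C * √X.rank < c * √k) (hΦ : Φ D ≤ 0) :
    ∃ W, IsContraction W ∧ Wᵀ = W ∧ traceNorm X < (W * (X + D)).trace := by
  obtain ⟨U, T, w, hU, hDT, hTr, hTfro, hW | hw⟩ := exists_tangent_decomposition hX hD
  · exact hW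
  exfalso
  have hk' : (0 : ℝ) < √k := Real.sqrt_pos.2 (by exact_mod_cast hk)
  set F : (Fin n → ℝ) → Matrix (Fin n) (Fin n) ℝ := fun d => U * Matrix.diagonal d * Uᵀ with hF
  have hFadd : ∀ d e, F (d + e) = F d + F e := by
    intro d e
    simp only [hF]
    rw [← add_mul, ← mul_add, Matrix.diagonal_add]
    rfl
  have hsp : ∀ d : Fin n → ℝ, (Finset.univ.filter fun i => d i ≠ 0).card ≤ k →
      Φ (F d) ≤ C * √(∑ i, d i ^ 2) := by
    intro d hd
    rw [← frobSq_conj_diagonal hU]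
    exact hup _ ((rank_conj_diagonal_le U d).trans hd)
  have hΨadd : ∀ d e, Φ (F (d + e)) ≤ Φ (F d) + Φ (F e) := fun d e => by
    rw [hFadd]; exact hadd _ _
  -- The head `S` collects the `k` largest eigenvalues of the orthogonal part, or all of them when
  -- `k > n`. It is kept with `T` to form a matrix of low rank; only the tail is estimated by
  -- blocks.
  obtain ⟨S, hSk, hS⟩ : ∃ S : Finset (Fin n), S.card ≤ k ∧ ∀ j ∉ S,
      |w j| ≤ (∑ i ∈ S, |w i|) / k := by
    rcases le_or_gt k (Finset.univ : Finset (Fin n)).card with h | h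
    · obtain ⟨S, -, hSk, hS⟩ := exists_top_subset (fun i => |w i|) Finset.univ k h
      exact ⟨S, hSk.le, fun j hj => le_average_of_top hk hSk fun i hi => hS i hi j (by simp [hj])⟩
    · exact ⟨Finset.univ, h.le, fun j hj => absurd (Finset.mem_univ j) hj⟩
  -- The head is written as a multiple of `w` so that `hTfro` applies.
  set e : Fin n → ℝ := fun i => w i * if i ∈ S then 1 else 0 with he
  set e' : Fin n → ℝ := fun i => if i ∈ S then 0 else w i with he'
  have hwe : w = e + e' := by
    ext i; by_cases h : i ∈ S <;> simp [he, he', h]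
  have hD' : T + F e = D + -F e' := by
    have : D = T + F w := hDT
    rw [this, hwe, hFadd]; abel
  have htail : Φ (F e') ≤ C * ((∑ i, |w i|) / √k) := by
    have h := le_of_le_on_sparse (Ψ := fun d => Φ (F d)) hC hk hΨadd hsp Finset.univ e'
      ((∑ i ∈ S, |w i|) / k) (by positivity) (fun i => by
        by_cases hi : i ∈ S
        · simp only [he', hi, if_true, abs_zero]; positivity
        · simpa [he', hi] using hS i hi) (by simp)
    refine h.trans (mul_le_mul_of_nonneg_left (le_of_eq ?_) hC)
    have h4 : ∑ i, |w i| = ∑ i ∈ S, |w i| + ∑ i, |e' i| := by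
      have : ∑ i ∈ S, |w i| = ∑ i, |e i| := by
        rw [← Finset.sum_subset (Finset.subset_univ S) (fun i _ hi => by simp [he, hi])]
        exact Finset.sum_congr rfl fun i hi => by simp [he, hi]
      rw [this, ← Finset.sum_add_distrib]
      refine Finset.sum_congr rfl fun i _ => ?_
      by_cases h : i ∈ S <;> simp [he, he', h]
    rw [h4, add_div, sqrt_mul_div]
  have hrank : (T + F e).rank ≤ 2 * X.rank + k := by
    refine (matrix_rank_add_le _ _).trans (add_le_add hTr ?_)
    refine (rank_conj_diagonal_le U e).trans ((Finset.card_le_card ?_).trans hSk)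
    intro i hi
    by_contra h
    exact (Finset.mem_filter.1 hi).2 (by simp [he, h])
  have hc : 0 < c := by
    by_contra h
    have h1 : c * √k ≤ 0 := mul_nonpos_of_nonpos_of_nonneg (not_lt.1 h) hk'.le
    have h2 : 0 ≤ C * √X.rank := by positivity
    linarith
  have h1 : c * √(frobSq T) ≤ C * ((∑ i, |w i|) / √k) := by
    calc c * √(frobSq T) ≤ c * √(frobSq (T + F e)) :=
          mul_le_mul_of_nonneg_left (Real.sqrt_le_sqrt (hTfro _)) hc.le
      _ ≤ Φ (T + F e) := hlow _ hrank
      _ ≤ Φ D + Φ (-F e') := by rw [hD']; exact hadd _ _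
      _ ≤ C * ((∑ i, |w i|) / √k) := by rw [hneg]; linarith
  have h2 : C * ((∑ i, |w i|) / √k) ≤ C * (√X.rank * √(frobSq T) / √k) := by gcongr
  -- The chain gives `c √k ‖T‖ ≤ C √r ‖T‖` in Frobenius norm, against `hkr` unless `T = 0`.
  have hT0 : √(frobSq T) ≤ 0 := by
    by_contra h
    push Not at h
    have h3 := h1.trans h2
    rw [← mul_div_assoc, le_div_iff₀ hk'] at h3
    nlinarith
  have hT00 : T = 0 := eq_zero_of_frobSq_le_zero (Real.sqrt_eq_zero'.1
    (le_antisymm hT0 (Real.sqrt_nonneg _)))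
  have hw0 : w = 0 := by
    have h5 : ∑ i, |w i| ≤ 0 := hw.trans (mul_nonpos_of_nonneg_of_nonpos (Real.sqrt_nonneg _) hT0)
    ext i
    have := Finset.single_le_sum (f := fun i => |w i|) (fun i _ => abs_nonneg _)
      (Finset.mem_univ i)
    exact abs_nonpos_iff.1 (this.trans h5)
  refine hD0 ?_
  rw [hDT, hT00, hw0]
  simp

/-- When `r = 0` there may be no measurements at all. The tangent part vanishes for rank reasons,
and the second alternative of the decomposition then forces `D = 0`. -/
theorem exists_isContraction_of_rank_eq_zero {n : ℕ} {X D : Matrix (Fin n) (Fin n) ℝ}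
    (hX : X.IsSymm) (hD : D.IsSymm) (hD0 : D ≠ 0) (hr : X.rank = 0) :
    ∃ W, IsContraction W ∧ Wᵀ = W ∧ traceNorm X < (W * (X + D)).trace := by
  obtain ⟨U, T, w, -, hDT, hTr, -, hW | hw⟩ := exists_tangent_decomposition hX hD
  · exact hW
  exfalso
  rw [hr] at hw hTr
  have hw0 : w = 0 := by
    ext i
    have := Finset.single_le_sum (f := fun i => |w i|) (fun i _ => abs_nonneg _)
      (Finset.mem_univ i)
    exact abs_nonpos_iff.1 (this.trans (by simpa using hw))
  have hT0 : T = 0 := by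
    have h : T.rank = 0 := by omega
    rw [Matrix.rank, Submodule.finrank_eq_zero, LinearMap.range_eq_bot, ← Matrix.toLin'_apply'] at h
    exact Matrix.toLin'.map_eq_zero_iff.1 h
  exact hD0 (by rw [hDT, hT0, hw0]; simp)

lemma traceNorm_le_trace_of_posSemidef {n : ℕ} {X : Matrix (Fin n) (Fin n) ℝ}
    (hX : X.PosSemidef) : traceNorm X ≤ X.trace := by
  refine (traceNorm_le_sum_norm X hX.isHermitian.eigenvectorBasis).trans (le_of_eq ?_)
  rw [hX.isHermitian.trace_eq_sum_eigenvalues]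
  refine Finset.sum_congr rfl fun i _ => ?_
  rw [Matrix.toLpLin_apply, hX.isHermitian.mulVec_eigenvectorBasis, WithLp.toLp_smul, norm_smul]
  simp [abs_of_nonneg (hX.eigenvalues_nonneg i)]

/-- If every nonzero symmetric perturbation of `X` with vanishing measurements is excluded by a
symmetric contraction, then trace-norm minimization recovers `X`. -/
theorem recovery_of_isContraction {n M : ℕ} {X : Matrix (Fin n) (Fin n) ℝ} (hX : X.IsSymm)
    (a : Fin M → E n)
    (h : ∀ D : Matrix (Fin n) (Fin n) ℝ, D.IsSymm → D ≠ 0 → (∀ i, quadMeasurement (a i) D = 0) →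
      ∃ W, IsContraction W ∧ Wᵀ = W ∧ traceNorm X < (W * (X + D)).trace) :
    IsSolution a (fun i => quadMeasurement (a i) X) X ∧
      ∀ H, IsSolution a (fun i => quadMeasurement (a i) X) H →
        (1 / 2 : ℝ) • (H + Hᵀ) = X ∧
        (H.IsSymm ∨ X.PosSemidef ∨ (-X).PosSemidef → H = X) := by
  have hquad : ∀ (x : E n) (A B : Matrix (Fin n) (Fin n) ℝ),
      quadMeasurement x (A + B) = quadMeasurement x A + quadMeasurement x B := by
    intro x A B; simp [quadMeasurement, Matrix.add_mulVec, dotProduct_add]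
  have hquadT : ∀ (x : E n) (A : Matrix (Fin n) (Fin n) ℝ),
      quadMeasurement x Aᵀ = quadMeasurement x A := by
    intro x A
    rw [quadMeasurement, quadMeasurement, Matrix.mulVec_transpose, dotProduct_comm,
      Matrix.dotProduct_mulVec]
  have hquads : ∀ (x : E n) (t : ℝ) (A : Matrix (Fin n) (Fin n) ℝ),
      quadMeasurement x (t • A) = t * quadMeasurement x A := by
    intro x t A; simp [quadMeasurement, Matrix.smul_mulVec, dotProduct_smul]
  have hsymtr : ∀ W B : Matrix (Fin n) (Fin n) ℝ, Wᵀ = W →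
      (W * ((1 / 2 : ℝ) • (B + Bᵀ))).trace = (Wᵀ * B).trace := by
    intro W B hW
    have : (W * Bᵀ).trace = (W * B).trace := by
      rw [← Matrix.trace_transpose, Matrix.transpose_mul, Matrix.transpose_transpose, hW,
        Matrix.trace_mul_comm]
    rw [Matrix.mul_smul, mul_add, Matrix.trace_smul, Matrix.trace_add, this, hW, smul_eq_mul]
    ring
  have hsym : ∀ B : Matrix (Fin n) (Fin n) ℝ, ((1 / 2 : ℝ) • (B + Bᵀ)).IsSymm := by
    intro B
    rw [Matrix.IsSymm, Matrix.transpose_smul, Matrix.transpose_add, Matrix.transpose_transpose,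
      add_comm]
  have hkey : ∀ B ∈ feasibleSet a (fun i => quadMeasurement (a i) X),
      traceNorm X ≤ traceNorm B ∧ (traceNorm B ≤ traceNorm X → (1 / 2 : ℝ) • (B + Bᵀ) = X) := by
    intro B hB
    by_cases hBX : (1 / 2 : ℝ) • (B + Bᵀ) = X
    · refine ⟨?_, fun _ => hBX⟩
      obtain ⟨W, hW, hWs, hle⟩ := exists_isContraction_traceNorm_le hX
      rw [← hBX, hsymtr W B hWs, hBX] at hle
      exact hle.trans (trace_le_traceNorm hW B)
    · obtain ⟨W, hW, hWs, hlt⟩ := h ((1 / 2 : ℝ) • (B + Bᵀ) - X)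
        (by rw [Matrix.IsSymm, Matrix.transpose_sub, (hsym B).eq, hX.eq])
        (sub_ne_zero.2 hBX) (fun i => by
          have h1 : (1 / 2 : ℝ) • (B + Bᵀ) - X = (1 / 2 : ℝ) • (B + Bᵀ) + (-1 : ℝ) • X := by
            rw [neg_one_smul, sub_eq_add_neg]
          rw [h1, hquad, hquads, hquads, hquad, hquadT, hB i]
          ring)
      -- As `W` is symmetric, the bound for the symmetric part of `B` transfers to `B` itself.
      rw [add_sub_cancel, hsymtr W B hWs] at hlt
      have h2 := hlt.trans_le (trace_le_traceNorm hW B)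
      exact ⟨h2.le, fun h3 => absurd h3 (not_le.2 h2)⟩
  have hXf : X ∈ feasibleSet a (fun i => quadMeasurement (a i) X) := fun i => rfl
  refine ⟨⟨hXf, fun B hB => (hkey B hB).1⟩, fun H hH => ?_⟩
  have hHle : traceNorm H ≤ traceNorm X := hH.2 X hXf
  have hHX := (hkey H hH.1).2 hHle
  refine ⟨hHX, ?_⟩
  have hfin : H.IsSymm → H = X := by
    intro hs
    rw [← hHX, hs.eq, ← two_smul ℝ H, smul_smul]
    norm_num
  have htrHX : H.trace = X.trace := by
    rw [← hHX, Matrix.trace_smul, Matrix.trace_add, Matrix.trace_transpose, smul_eq_mul]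
    ring
  rintro (hs | hp | hp)
  · exact hfin hs
  -- In the semidefinite case `‖H‖₁ ≤ ‖X‖₁ ≤ tr X = tr H`, and such an `H` is symmetric.
  · refine hfin (isSymm_of_traceNorm_le_trace (hHle.trans ?_))
    rw [htrHX]
    exact traceNorm_le_trace_of_posSemidef hp
  · refine hfin ?_
    have h1 : (-H).IsSymm := isSymm_of_traceNorm_le_trace (by
      rw [Matrix.trace_neg, htrHX, ← Matrix.trace_neg]
      refine (traceNorm_neg_le H).trans (hHle.trans ?_)
      have := traceNorm_neg_le (-X)
      rw [neg_neg] at this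
      exact this.trans (traceNorm_le_trace_of_posSemidef hp))
    simpa using h1.neg

/-! ### Nets in the unit ball of a finite-dimensional space -/

section Nets

open MeasureTheory Metric Module

variable {V : Type*} [NormedAddCommGroup V] [NormedSpace ℝ V] [FiniteDimensional ℝ V]

/-- A separated subset of the unit ball has cardinality at most exponential in the dimension. -/
theorem card_le_of_separated_unitBall {ε : ℝ} (hε : 0 < ε) (s : Finset V)
    (hs : ∀ c ∈ s, ‖c‖ ≤ 1) (h : ∀ c ∈ s, ∀ d ∈ s, c ≠ d → ε ≤ ‖c - d‖) :
    (s.card : ℝ) ≤ (1 + 2 / ε) ^ finrank ℝ V := by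
  borelize V
  let μ : Measure V := Measure.addHaar
  set δ : ℝ := ε / 2 with hδ
  set ρ : ℝ := 1 + ε / 2 with hρ
  have δpos : 0 < δ := by positivity
  have ρpos : 0 < ρ := by positivity
  set A := ⋃ c ∈ s, ball (c : V) δ with hA
  -- Volume comparison: disjoint balls of radius `ε/2` inside a ball of radius `1 + ε/2`.
  have D : Set.Pairwise (s : Set V) (Function.onFun Disjoint fun c => ball (c : V) δ) := by
    rintro c hc d hd hcd
    apply ball_disjoint_ball
    rw [dist_eq_norm]
    have := h c hc d hd hcd
    linarith
  have A_subset : A ⊆ ball (0 : V) ρ := by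
    refine Set.iUnion₂_subset fun x hx => ?_
    apply ball_subset_ball'
    have := hs x hx
    rw [dist_zero_right]
    linarith
  have I : (s.card : ENNReal) * ENNReal.ofReal (δ ^ finrank ℝ V) * μ (ball 0 1) ≤
      ENNReal.ofReal (ρ ^ finrank ℝ V) * μ (ball 0 1) :=
    calc
      _ = μ A := by
        rw [hA, measure_biUnion_finset D fun c _ => measurableSet_ball]
        simp only [μ.addHaar_ball_of_pos _ δpos]
        simp only [Finset.sum_const, nsmul_eq_mul, mul_assoc]
      _ ≤ μ (ball (0 : V) ρ) := measure_mono A_subset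
      _ = _ := by simp only [μ.addHaar_ball_of_pos _ ρpos]
  have J : (s.card : ENNReal) * ENNReal.ofReal (δ ^ finrank ℝ V) ≤
      ENNReal.ofReal (ρ ^ finrank ℝ V) :=
    (ENNReal.mul_le_mul_iff_left (measure_ball_pos _ _ zero_lt_one).ne' measure_ball_lt_top.ne).1 I
  have K := ENNReal.toReal_le_of_le_ofReal (pow_nonneg ρpos.le _) J
  rw [ENNReal.toReal_mul, ENNReal.toReal_natCast,
    ENNReal.toReal_ofReal (pow_nonneg δpos.le _), ← le_div_iff₀ (by positivity), ← div_pow] at K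
  refine K.trans (le_of_eq ?_)
  congr 1
  rw [hρ, hδ]
  field_simp
  ring

/-- A maximal separated set is a net. If no net met the size bound, every separated set, being
small, could be enlarged, giving separated sets of every cardinality. -/
theorem exists_net_unitBall (V : Type*) [NormedAddCommGroup V] [NormedSpace ℝ V]
    [FiniteDimensional ℝ V] {ε : ℝ} (hε : 0 < ε) :
    ∃ T : Finset V, (∀ t ∈ T, ‖t‖ ≤ 1) ∧ (∀ x : V, ‖x‖ ≤ 1 → ∃ t ∈ T, ‖x - t‖ ≤ ε) ∧
      (T.card : ℝ) ≤ (1 + 2 / ε) ^ finrank ℝ V := by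
  classical
  by_contra hcon
  push Not at hcon
  have hsep : ∀ N : ℕ, ∃ s : Finset V, s.card = N ∧ (∀ c ∈ s, ‖c‖ ≤ 1) ∧
      ∀ c ∈ s, ∀ d ∈ s, c ≠ d → ε ≤ ‖c - d‖ := by
    intro N
    induction N with
    | zero => exact ⟨∅, by simp⟩
    | succ N ih =>
      obtain ⟨s, hN, hs, hsd⟩ := ih
      have hx : ∃ x : V, ‖x‖ ≤ 1 ∧ ∀ t ∈ s, ε < ‖x - t‖ := by
        by_contra hne
        push Not at hne
        exact absurd (card_le_of_separated_unitBall hε s hs hsd) (not_le.2 (hcon s hs hne))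
      obtain ⟨x, hx, hxs⟩ := hx
      refine ⟨insert x s, ?_, ?_, ?_⟩
      · rw [Finset.card_insert_of_notMem, hN]
        intro hmem
        have := hxs x hmem
        rw [sub_self, norm_zero] at this
        linarith
      · intro c hc
        rcases Finset.mem_insert.1 hc with rfl | hc
        exacts [hx, hs c hc]
      · intro c hc d hd hcd
        rcases Finset.mem_insert.1 hc with rfl | hc' <;> rcases Finset.mem_insert.1 hd with rfl | hd'
        · exact absurd rfl hcd
        · exact (hxs d hd').le
        · rw [norm_sub_rev]; exact (hxs c hc').le
        · exact hsd c hc' d hd' hcd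
  obtain ⟨N, hN⟩ := exists_nat_gt ((1 + 2 / ε) ^ finrank ℝ V)
  obtain ⟨s, hsN, hs, hsd⟩ := hsep N
  have := card_le_of_separated_unitBall hε s hs hsd
  rw [hsN] at this
  linarith

end Nets

/-! ### Low-rank maps as products of two factors -/

/-- The columns of a linear map, as a Hilbert space element. -/
noncomputable def cols {m n : ℕ} (A : E n →L[ℝ] E m) : PiLp 2 (fun _ : Fin n => E m) :=
  WithLp.toLp 2 fun j => A (EuclideanSpace.single j 1)

/-- The linear map with given columns. -/
noncomputable def ofCols (m n : ℕ) : PiLp 2 (fun _ : Fin n => E m) →ₗ[ℝ] (E n →L[ℝ] E m) where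
  toFun Y := ∑ j, (EuclideanSpace.proj j : E n →L[ℝ] ℝ).smulRight (Y j)
  map_add' Y Z := by
    rw [← Finset.sum_add_distrib]
    refine Finset.sum_congr rfl fun j _ => ?_
    ext v; simp
  map_smul' t Y := by
    rw [RingHom.id_apply, Finset.smul_sum]
    refine Finset.sum_congr rfl fun j _ => ?_
    ext v; simp; ring

lemma ofCols_apply {m n : ℕ} (Y : PiLp 2 (fun _ : Fin n => E m)) (v : E n) :
    ofCols m n Y v = ∑ j, v j • Y j := by
  simp [ofCols]

lemma cols_ofCols {m n : ℕ} (Y : PiLp 2 (fun _ : Fin n => E m)) : cols (ofCols m n Y) = Y := by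
  ext j i
  simp [cols, ofCols_apply]

lemma ofCols_cols {m n : ℕ} (A : E n →L[ℝ] E m) : ofCols m n (cols A) = A := by
  ext1 v
  rw [ofCols_apply]
  conv_rhs => rw [← (EuclideanSpace.basisFun (Fin n) ℝ).sum_repr v]
  simp [cols]

lemma cols_add {m n : ℕ} (A B : E n →L[ℝ] E m) : cols (A + B) = cols A + cols B := by
  ext j i; simp [cols]

lemma cols_smul {m n : ℕ} (t : ℝ) (A : E n →L[ℝ] E m) : cols (t • A) = t • cols A := by
  ext j i; simp [cols]

lemma norm_cols_comp_le {l m n : ℕ} (X : E m →L[ℝ] E l) (L : E n →L[ℝ] E m) :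
    ‖cols (X ∘L L)‖ ≤ ‖X‖ * ‖cols L‖ := by
  refine le_of_sq_le_sq ?_ (by positivity)
  rw [mul_pow, PiLp.norm_sq_eq_of_L2, PiLp.norm_sq_eq_of_L2, Finset.mul_sum]
  refine Finset.sum_le_sum fun j _ => ?_
  rw [← mul_pow]
  exact pow_le_pow_left₀ (norm_nonneg _) (X.le_opNorm _) 2

/-- The `ℓ¹`-norm of the bilinear measurements `⟨u, A v⟩`. -/
noncomputable def bilinearL1 {n M : ℕ} (p : Fin M → E n × E n) (A : E n →L[ℝ] E n) : ℝ :=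
  ∑ i, |inner ℝ (p i).1 (A (p i).2)|

lemma bilinearL1_nonneg {n M : ℕ} (p : Fin M → E n × E n) (A : E n →L[ℝ] E n) :
    0 ≤ bilinearL1 p A := Finset.sum_nonneg fun _ _ => abs_nonneg _

lemma bilinearL1_add_le {n M : ℕ} (p : Fin M → E n × E n) (A B : E n →L[ℝ] E n) :
    bilinearL1 p (A + B) ≤ bilinearL1 p A + bilinearL1 p B := by
  rw [bilinearL1, bilinearL1, bilinearL1, ← Finset.sum_add_distrib]
  refine Finset.sum_le_sum fun i _ => ?_
  rw [_root_.add_apply, inner_add_right]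
  exact abs_add_le _ _

lemma bilinearL1_smul {n M : ℕ} (p : Fin M → E n × E n) (t : ℝ) (A : E n →L[ℝ] E n) :
    bilinearL1 p (t • A) = |t| * bilinearL1 p A := by
  rw [bilinearL1, bilinearL1, Finset.mul_sum]
  refine Finset.sum_congr rfl fun i _ => ?_
  rw [_root_.smul_apply, inner_smul_right, abs_mul]

lemma continuous_bilinearL1 {n M : ℕ} (p : Fin M → E n × E n) : Continuous (bilinearL1 p) := by
  unfold bilinearL1
  fun_prop

/-- A linear map of rank at most `m` factors through `ℝᵐ`. -/
lemma exists_factorization {m n : ℕ} (A : E n →L[ℝ] E n)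
    (hA : Module.finrank ℝ (LinearMap.range (A : E n →ₗ[ℝ] E n)) ≤ m) :
    ∃ (X : E m →L[ℝ] E n) (L : E n →L[ℝ] E m), ‖X‖ ≤ 1 ∧ X ∘L L = A ∧ ‖cols L‖ = ‖cols A‖ := by
  set R := LinearMap.range (A : E n →ₗ[ℝ] E n) with hR
  let b := stdOrthonormalBasis ℝ R
  let g : R →ₗ[ℝ] E m := b.toBasis.constr ℝ fun j => EuclideanSpace.single (Fin.castLE hA j) (1 : ℝ)
  have hg : Orthonormal ℝ (g ∘ b.toBasis) := by
    have h1 : g ∘ b.toBasis = EuclideanSpace.basisFun (Fin m) ℝ ∘ Fin.castLE hA := by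
      ext1 j
      simp only [Function.comp_apply, g, Module.Basis.constr_basis, EuclideanSpace.basisFun_apply]
    rw [h1]
    exact (EuclideanSpace.basisFun (Fin m) ℝ).orthonormal.comp _ (Fin.castLE_injective hA)
  let e : R →ₗᵢ[ℝ] E m := g.isometryOfOrthonormal (v := b.toBasis)
    (by rw [b.coe_toBasis]; exact b.orthonormal) hg
  let A' : E n →L[ℝ] R := LinearMap.toContinuousLinearMap ((A : E n →ₗ[ℝ] E n).rangeRestrict)
  let eC : R →L[ℝ] E m := e.toContinuousLinearMap
  have hA' : ∀ v, (A' v : E n) = A v := fun v => rfl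
  have hee : ∀ x, ContinuousLinearMap.adjoint eC (eC x) = x := by
    intro x
    refine ext_inner_right ℝ fun y => ?_
    rw [ContinuousLinearMap.adjoint_inner_left]
    exact e.inner_map_map x y
  -- With `e` an isometric embedding of the range of `A` in `ℝᵐ`, take `L = e ∘ A`, which preserves
  -- column norms, and let `X` undo `e`.
  refine ⟨R.subtypeL ∘L ContinuousLinearMap.adjoint eC, eC ∘L A', ?_, ?_, ?_⟩
  · refine (ContinuousLinearMap.opNorm_comp_le _ _).trans ?_
    rw [LinearIsometryEquiv.norm_map]
    exact mul_le_one₀ R.norm_subtypeL_le (norm_nonneg eC) e.norm_toContinuousLinearMap_le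
  · ext1 v
    simp only [ContinuousLinearMap.comp_apply, hee]
    exact hA' v
  · refine (sq_eq_sq₀ (norm_nonneg _) (norm_nonneg _)).1 ?_
    rw [PiLp.norm_sq_eq_of_L2, PiLp.norm_sq_eq_of_L2]
    refine Finset.sum_congr rfl fun j _ => ?_
    have h1 : cols (eC ∘L A') j = e (A' (EuclideanSpace.single j 1)) := rfl
    rw [h1, e.norm_map]
    rfl

/-- The parameter space of factorizations through `ℝᵐ`. -/
abbrev FactorSpace (m n : ℕ) : Type := (E m →L[ℝ] E n) × PiLp 2 (fun _ : Fin n => E m)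

/-- The product of the two factors. -/
noncomputable def FactorSpace.prod {m n : ℕ} (p : FactorSpace m n) : E n →L[ℝ] E n :=
  p.1 ∘L ofCols m n p.2

lemma finrank_factorSpace (m n : ℕ) : Module.finrank ℝ (FactorSpace m n) = 2 * (m * n) := by
  have h1 : Module.finrank ℝ (E m →L[ℝ] E n) = m * n := by
    rw [← LinearMap.toContinuousLinearMap.finrank_eq, Module.finrank_linearMap]
    simp
  have h2 : Module.finrank ℝ (PiLp 2 (fun _ : Fin n => E m)) = m * n := by
    rw [(WithLp.linearEquiv 2 ℝ (Fin n → E m)).finrank_eq, Module.finrank_pi_fintype]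
    simp [mul_comm]
  rw [Module.finrank_prod, h1, h2, two_mul]

lemma norm_cols_prod_le {m n : ℕ} (p : FactorSpace m n) : ‖cols p.prod‖ ≤ ‖p.1‖ * ‖p.2‖ := by
  have := norm_cols_comp_le p.1 (ofCols m n p.2)
  rwa [cols_ofCols] at this

lemma continuous_factorSpace_prod (m n : ℕ) :
    Continuous (FactorSpace.prod : FactorSpace m n → E n →L[ℝ] E n) := by
  have : ContinuousSMul ℝ (PiLp 2 (fun _ : Fin n => E m)) := IsBoundedSMul.continuousSMul
  have h : Continuous (ofCols m n) := LinearMap.continuous_of_finiteDimensional _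
  unfold FactorSpace.prod
  fun_prop

/-- The error of replacing a factorization by a net point is again a sum of two products, each with
one small factor. This is why the net lives on factor pairs and not on matrices. -/
lemma factorSpace_prod_sub {m n : ℕ} (p t : FactorSpace m n) :
    p.prod = t.prod + (FactorSpace.prod (p.1 - t.1, p.2) + FactorSpace.prod (t.1, p.2 - t.2)) := by
  ext1 v
  simp [FactorSpace.prod, map_sub]

lemma bilinearL1_prod_le {M m n : ℕ} {p : Fin M → E n × E n} {B : ℝ}
    (hB : ∀ q : FactorSpace m n, ‖q‖ ≤ 1 → bilinearL1 p q.prod ≤ B) (q : FactorSpace m n) :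
    bilinearL1 p q.prod ≤ B * (‖q.1‖ * ‖q.2‖) := by
  have h1 : q.prod = (‖q.1‖ * ‖q.2‖) • FactorSpace.prod (‖q.1‖⁻¹ • q.1, ‖q.2‖⁻¹ • q.2) := by
    rcases eq_or_ne q.1 0 with h | h
    · ext1 v
      simp [FactorSpace.prod, h]
    rcases eq_or_ne q.2 0 with h' | h'
    · ext1 v
      simp [FactorSpace.prod, h']
    ext1 v
    have h2 : ‖q.1‖ ≠ 0 := norm_ne_zero_iff.2 h
    have h3 : ‖q.2‖ ≠ 0 := norm_ne_zero_iff.2 h'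
    simp only [FactorSpace.prod, map_smul, ContinuousLinearMap.comp_apply, _root_.smul_apply,
      smul_smul]
    rw [show ‖q.1‖ * ‖q.2‖ * (‖q.2‖⁻¹ * ‖q.1‖⁻¹) = 1 by field_simp, one_smul]
  rw [h1, bilinearL1_smul, abs_of_nonneg (by positivity), mul_comm]
  refine mul_le_mul_of_nonneg_right (hB _ ?_) (by positivity)
  rw [Prod.norm_def]
  refine max_le ?_ ?_ <;> simp only [norm_smul, norm_inv, norm_norm] <;> exact inv_mul_le_one

/-- Two-sided bounds for the bilinear measurements on a net of factorizations extend to all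
linear maps of low rank. -/
theorem restricted_isometry_of_net {M m n : ℕ} (p : Fin M → E n × E n) {b : ℝ} (hb : 0 ≤ b)
    (T : Finset (FactorSpace m n)) (hT1 : ∀ t ∈ T, ‖t‖ ≤ 1)
    (hT : ∀ q : FactorSpace m n, ‖q‖ ≤ 1 → ∃ t ∈ T, ‖q - t‖ ≤ 1 / 25000)
    (hup : ∀ t ∈ T, bilinearL1 p t.prod ≤ 4 * b)
    (hlow : ∀ t ∈ T, b / 640 * ‖cols t.prod‖ ≤ bilinearL1 p t.prod)
    (A : E n →L[ℝ] E n) (hA : Module.finrank ℝ (LinearMap.range (A : E n →ₗ[ℝ] E n)) ≤ m) :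
    b / 1280 * ‖cols A‖ ≤ bilinearL1 p A ∧ bilinearL1 p A ≤ 8 * b * ‖cols A‖ := by
  have hstep : ∀ {B : ℝ}, 0 ≤ B → (∀ q : FactorSpace m n, ‖q‖ ≤ 1 → bilinearL1 p q.prod ≤ B) →
      ∀ q t : FactorSpace m n, ‖q‖ ≤ 1 → ‖t‖ ≤ 1 → ‖q - t‖ ≤ 1 / 25000 →
        bilinearL1 p (FactorSpace.prod (q.1 - t.1, q.2) + FactorSpace.prod (t.1, q.2 - t.2)) ≤
          B / 12500 := by
    intro B hB0 hB q t hq ht hqt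
    refine (bilinearL1_add_le p _ _).trans ?_
    have h1 := bilinearL1_prod_le hB (q.1 - t.1, q.2)
    have h2 := bilinearL1_prod_le hB (t.1, q.2 - t.2)
    have h3 : ‖q.1 - t.1‖ * ‖q.2‖ ≤ 1 / 25000 * 1 :=
      mul_le_mul ((norm_fst_le (q - t)).trans hqt) ((norm_snd_le q).trans hq) (norm_nonneg _)
        (by norm_num)
    have h4 : ‖t.1‖ * ‖q.2 - t.2‖ ≤ 1 * (1 / 25000) :=
      mul_le_mul ((norm_fst_le t).trans ht) ((norm_snd_le (q - t)).trans hqt) (norm_nonneg _)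
        (by norm_num)
    dsimp only at h1 h2
    have h5 := mul_le_mul_of_nonneg_left h3 hB0
    have h6 := mul_le_mul_of_nonneg_left h4 hB0
    linarith
  -- By compactness the supremum `B` is attained; approximating the maximizer by a net point gives
  -- `B ≤ 4b + B/12500`, whence `B ≤ 8b`.
  have hball : ∀ q : FactorSpace m n, ‖q‖ ≤ 1 → bilinearL1 p q.prod ≤ 8 * b := by
    obtain ⟨q₀, hq₀, hmax⟩ := (isCompact_closedBall (0 : FactorSpace m n) 1).exists_isMaxOn
      ⟨0, by simp⟩ ((continuous_bilinearL1 p).comp (continuous_factorSpace_prod m n)).continuousOn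
    have hB : ∀ q : FactorSpace m n, ‖q‖ ≤ 1 → bilinearL1 p q.prod ≤ bilinearL1 p q₀.prod :=
      fun q hq => hmax (by simpa using hq)
    have hq₀' : ‖q₀‖ ≤ 1 := by simpa using hq₀
    obtain ⟨t, htT, ht⟩ := hT q₀ hq₀'
    have h1 := hstep (bilinearL1_nonneg _ _) hB q₀ t hq₀' (hT1 t htT) ht
    have h2 := bilinearL1_add_le p t.prod
      (FactorSpace.prod (q₀.1 - t.1, q₀.2) + FactorSpace.prod (t.1, q₀.2 - t.2))
    rw [← factorSpace_prod_sub] at h2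
    have h3 := hup t htT
    intro q hq
    have h4 := hB q hq
    linarith
  have hunit : ∀ A : E n →L[ℝ] E n,
      Module.finrank ℝ (LinearMap.range (A : E n →ₗ[ℝ] E n)) ≤ m → ‖cols A‖ = 1 →
      b / 1280 ≤ bilinearL1 p A ∧ bilinearL1 p A ≤ 8 * b := by
    intro A hA hA1
    obtain ⟨X, L, hX, hXL, hL⟩ := exists_factorization A hA
    set q : FactorSpace m n := (X, cols L) with hq
    have hqA : q.prod = A := by rw [FactorSpace.prod, hq, ofCols_cols, hXL]
    have hq1 : ‖q‖ ≤ 1 := by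
      rw [Prod.norm_def]
      exact max_le hX (by rw [hq, hL, hA1])
    refine ⟨?_, hqA ▸ hball q hq1⟩
    obtain ⟨t, htT, ht⟩ := hT q hq1
    have ht1 := hT1 t htT
    set R := FactorSpace.prod (q.1 - t.1, q.2) + FactorSpace.prod (t.1, q.2 - t.2) with hR
    have h1 : bilinearL1 p R ≤ 8 * b / 12500 :=
      hstep (by positivity) hball q t hq1 ht1 ht
    have hRcols : ‖cols R‖ ≤ 1 / 12500 := by
      rw [hR, cols_add]
      refine (norm_add_le _ _).trans ?_
      have h2 := norm_cols_prod_le (q.1 - t.1, q.2)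
      have h3 := norm_cols_prod_le (t.1, q.2 - t.2)
      have h4 : ‖q.1 - t.1‖ * ‖q.2‖ ≤ 1 / 25000 * 1 :=
        mul_le_mul ((norm_fst_le (q - t)).trans ht) ((norm_snd_le q).trans hq1) (norm_nonneg _)
          (by norm_num)
      have h5 : ‖t.1‖ * ‖q.2 - t.2‖ ≤ 1 * (1 / 25000) :=
        mul_le_mul ((norm_fst_le t).trans ht1) ((norm_snd_le (q - t)).trans ht) (norm_nonneg _)
          (by norm_num)
      dsimp only at h2 h3
      linarith
    have hAt : A = t.prod + R := by rw [← hqA]; exact factorSpace_prod_sub q t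
    have htA : t.prod = A + (-1 : ℝ) • R := by rw [hAt]; module
    have h6 : 1 - 1 / 12500 ≤ ‖cols t.prod‖ := by
      have : ‖cols A‖ ≤ ‖cols t.prod‖ + ‖cols R‖ := by
        conv_lhs => rw [hAt, cols_add]
        exact norm_add_le _ _
      rw [hA1] at this
      linarith
    have h7 : bilinearL1 p t.prod ≤ bilinearL1 p A + bilinearL1 p R := by
      rw [htA]
      refine (bilinearL1_add_le p _ _).trans (le_of_eq ?_)
      rw [bilinearL1_smul]; simp
    have h8 := hlow t htT
    have h9 : b / 640 * (1 - 1 / 12500) ≤ b / 640 * ‖cols t.prod‖ :=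
      mul_le_mul_of_nonneg_left h6 (by positivity)
    -- The radius `1/25000` is small enough that the error `8b/12500` leaves more than half of the
    -- lower bound `b/640`.
    linarith
  rcases eq_or_ne (cols A) 0 with h0 | h0
  · have hA0 : A = 0 := by rw [← ofCols_cols A, h0, map_zero]
    rw [h0, norm_zero, mul_zero, mul_zero, hA0]
    simp [bilinearL1]
  · have hn : 0 < ‖cols A‖ := norm_pos_iff.2 h0
    have h1 := hunit (‖cols A‖⁻¹ • A) ?_ ?_
    · rw [bilinearL1_smul, abs_of_nonneg (by positivity), inv_mul_eq_div, le_div_iff₀ hn,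
        div_le_iff₀ hn] at h1
      exact h1
    · refine (Submodule.finrank_mono ?_).trans hA
      rintro _ ⟨v, rfl⟩
      exact ⟨‖cols A‖⁻¹ • v, by simp⟩
    · rw [cols_smul, norm_smul, norm_inv, norm_norm, inv_mul_cancel₀ hn.ne']

/-! ### Exponential moments of Gaussian bilinear forms -/

section Gaussian

open MeasureTheory ProbabilityTheory

/-- The standard Gaussian measure on `ℝⁿ`. -/
noncomputable abbrev gauss (n : ℕ) : Measure (E n) := stdGaussian (E n)

lemma hasLaw_inner_gauss {n : ℕ} (w : E n) :
    HasLaw (fun u => inner ℝ w u) (gaussianReal 0 (‖w‖ ^ 2).toNNReal) (gauss n) where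
  aemeasurable := by fun_prop
  map_eq := by
    have h := IsGaussian.map_eq_gaussianReal (μ := gauss n) (innerSL ℝ w)
    rw [integral_strongDual_stdGaussian, variance_dual_stdGaussian, innerSL_apply_norm] at h
    exact h

lemma integral_inner_sq_gauss {n : ℕ} (w : E n) :
    ∫ u, (inner ℝ w u) ^ 2 ∂(gauss n) = ‖w‖ ^ 2 := by
  have h := variance_dual_stdGaussian (E := E n) (innerSL ℝ w)
  rw [variance_of_integral_eq_zero (by fun_prop) (integral_strongDual_stdGaussian _),
    innerSL_apply_norm] at h
  exact h

lemma lintegral_exp_abs_inner_le {n : ℕ} (w : E n) :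
    ∫⁻ u, ENNReal.ofReal (Real.exp (|inner ℝ w u| / 2)) ∂(gauss n) ≤
      ENNReal.ofReal (2 * Real.exp (‖w‖ ^ 2 / 8)) := by
  have hm : ∀ t : ℝ, ∫⁻ u, ENNReal.ofReal (Real.exp (t * inner ℝ w u)) ∂(gauss n) =
      ENNReal.ofReal (Real.exp (‖w‖ ^ 2 * t ^ 2 / 2)) := by
    intro t
    have h1 := mgf_gaussianReal (hasLaw_inner_gauss w).map_eq t
    rw [zero_mul, zero_add, Real.coe_toNNReal _ (by positivity)] at h1
    rw [← h1, mgf, ofReal_integral_eq_lintegral_ofReal]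
    -- A non-integrable exponential would have Bochner integral `0`, whereas the Gaussian formula is
    -- positive.
    · by_contra hni
      rw [mgf, integral_undef hni] at h1
      exact (Real.exp_pos _).ne h1
    · exact Filter.Eventually.of_forall fun _ => (Real.exp_pos _).le
  calc _ ≤ ∫⁻ u, (ENNReal.ofReal (Real.exp (1 / 2 * inner ℝ w u)) +
        ENNReal.ofReal (Real.exp (-(1 / 2) * inner ℝ w u))) ∂(gauss n) := by
        refine lintegral_mono fun u => ?_
        rw [← ENNReal.ofReal_add (Real.exp_pos _).le (Real.exp_pos _).le]
        refine ENNReal.ofReal_le_ofReal ?_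
        rcases abs_cases (inner ℝ w u : ℝ) with ⟨h, -⟩ | ⟨h, -⟩ <;> rw [h]
        · have := Real.exp_pos (-(1 / 2) * inner ℝ w u)
          rw [show (inner ℝ w u : ℝ) / 2 = 1 / 2 * inner ℝ w u by ring]
          linarith
        · have := Real.exp_pos (1 / 2 * inner ℝ w u)
          rw [show -(inner ℝ w u : ℝ) / 2 = -(1 / 2) * inner ℝ w u by ring]
          linarith
    _ = ENNReal.ofReal (2 * Real.exp (‖w‖ ^ 2 / 8)) := by
        rw [lintegral_add_left (by fun_prop), hm, hm, ← ENNReal.ofReal_add (by positivity)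
          (by positivity)]
        congr 1
        rw [two_mul]
        congr 2 <;> ring

/-- The integral equals `√(4/3)`; the round bound `2` suffices. -/
lemma lintegral_exp_sq_gaussianReal_le :
    ∫⁻ x, ENNReal.ofReal (Real.exp (x ^ 2 / 8)) ∂(gaussianReal 0 1) ≤ 2 := by
  rw [gaussianReal_of_var_ne_zero _ one_ne_zero,
    lintegral_withDensity_eq_lintegral_mul _ (measurable_gaussianPDF 0 1) (by fun_prop)]
  have h1 : ∀ x : ℝ, (gaussianPDF 0 1 * fun x => ENNReal.ofReal (Real.exp (x ^ 2 / 8))) x =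
      ENNReal.ofReal ((√(2 * Real.pi))⁻¹ * Real.exp (-(3 / 8) * x ^ 2)) := by
    intro x
    rw [Pi.mul_apply, gaussianPDF, ← ENNReal.ofReal_mul (gaussianPDFReal_nonneg _ _ _),
      gaussianPDFReal, mul_assoc, ← Real.exp_add]
    simp only [NNReal.coe_one, mul_one, sub_zero]
    congr 3
    ring
  simp only [h1]
  rw [← ofReal_integral_eq_lintegral_ofReal
    ((integrable_exp_neg_mul_sq (by norm_num)).const_mul _)
    (Filter.Eventually.of_forall fun _ => by positivity), integral_const_mul, integral_gaussian,
    ← Real.sqrt_inv, ← Real.sqrt_mul (by positivity)]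
  refine ENNReal.ofReal_le_of_le_toReal ?_
  rw [ENNReal.toReal_ofNat, Real.sqrt_le_left (by norm_num)]
  have := Real.pi_pos
  rw [show (2 * Real.pi)⁻¹ * (Real.pi / (3 / 8)) = 4 / 3 by field_simp; norm_num]
  norm_num

lemma lintegral_exp_inner_sq_le {n : ℕ} {e : E n} (he : ‖e‖ ≤ 1) :
    ∫⁻ v, ENNReal.ofReal (Real.exp ((inner ℝ e v) ^ 2 / 8)) ∂(gauss n) ≤ 2 := by
  have h1 : HasLaw (fun x : ℝ => ‖e‖ * x) (gaussianReal 0 (‖e‖ ^ 2).toNNReal)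
      (gaussianReal 0 1) := by
    refine ⟨by fun_prop, ?_⟩
    rw [gaussianReal_map_const_mul]
    congr 1
    · simp
    · ext; simp
  rw [(hasLaw_inner_gauss e).lintegral_comp (f := fun x => ENNReal.ofReal (Real.exp (x ^ 2 / 8)))
    (by fun_prop), ← h1.lintegral_comp (by fun_prop)]
  refine (lintegral_mono fun x => ENNReal.ofReal_le_ofReal (Real.exp_le_exp.2 ?_)).trans
    lintegral_exp_sq_gaussianReal_le
  rw [mul_pow]
  have h2 : ‖e‖ ^ 2 ≤ 1 := pow_le_one₀ (norm_nonneg _) he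
  nlinarith [sq_nonneg x]

/-- The `i`-th row of a linear map. -/
noncomputable def row {m n : ℕ} (L : E n →L[ℝ] E m) (i : Fin m) : E n :=
  ContinuousLinearMap.adjoint L (EuclideanSpace.single i 1)

lemma inner_row {m n : ℕ} (L : E n →L[ℝ] E m) (i : Fin m) (v : E n) :
    inner ℝ (row L i) v = L v i := by
  rw [row, ContinuousLinearMap.adjoint_inner_left, EuclideanSpace.inner_single_left]
  simp

lemma norm_sq_eq_sum_inner_row {m n : ℕ} (L : E n →L[ℝ] E m) (v : E n) :
    ‖L v‖ ^ 2 = ∑ i, (inner ℝ (row L i) v) ^ 2 := by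
  rw [EuclideanSpace.norm_sq_eq]
  simp [inner_row]

lemma sum_norm_row_sq {m n : ℕ} (L : E n →L[ℝ] E m) : ∑ i, ‖row L i‖ ^ 2 = ‖cols L‖ ^ 2 := by
  rw [PiLp.norm_sq_eq_of_L2]
  simp only [EuclideanSpace.norm_sq_eq, Real.norm_eq_abs, sq_abs]
  rw [Finset.sum_comm]
  refine Finset.sum_congr rfl fun j _ => Finset.sum_congr rfl fun i _ => ?_
  have h : row L i j = inner ℝ (row L i) (EuclideanSpace.single j 1) := by
    rw [EuclideanSpace.inner_single_right]; simp
  rw [h, inner_row]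
  rfl

lemma lintegral_exp_norm_sq_le {m n : ℕ} {L : E n →L[ℝ] E m} (hL : ‖cols L‖ ≤ 1) :
    ∫⁻ v, ENNReal.ofReal (Real.exp (‖L v‖ ^ 2 / 8)) ∂(gauss n) ≤ 2 := by
  set μ : Fin m → ℝ := fun i => ‖row L i‖ ^ 2 with hμ
  set e : Fin m → E n := fun i => ‖row L i‖⁻¹ • row L i with he
  have hμ1 : ∑ i, μ i ≤ 1 := by
    rw [sum_norm_row_sq]; exact pow_le_one₀ (norm_nonneg _) hL
  have hμ0 : ∀ i, 0 ≤ μ i := fun i => by positivity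
  have he1 : ∀ i, ‖e i‖ ≤ 1 := fun i => by
    simp only [he, norm_smul, norm_inv, norm_norm]; exact inv_mul_le_one
  have hrow : ∀ i v, (inner ℝ (row L i) v) ^ 2 = μ i * (inner ℝ (e i) v) ^ 2 := by
    intro i v
    rcases eq_or_ne (row L i) 0 with h | h
    · simp [hμ, h]
    · have : ‖row L i‖ ≠ 0 := norm_ne_zero_iff.2 h
      simp only [hμ, he, real_inner_smul_left]
      field_simp
  have hJ : ∀ v, Real.exp (‖L v‖ ^ 2 / 8) ≤
      (1 - ∑ i, μ i) + ∑ i, μ i * Real.exp ((inner ℝ (e i) v) ^ 2 / 8) := by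
    intro v
    -- Jensen with the squared row norms as weights reduces to one Gaussian coordinate per row; the
    -- missing weight is placed at `0`.
    have h := convexOn_exp.map_add_sum_le (t := Finset.univ) (w := μ) (v := 1 - ∑ i, μ i)
      (p := fun i => (inner ℝ (e i) v) ^ 2 / 8) (q := 0) (fun i _ => hμ0 i) (by ring)
      (fun _ _ => Set.mem_univ _) (by linarith) (Set.mem_univ _)
    simp only [smul_eq_mul, mul_zero, zero_add, Real.exp_zero, mul_one] at h
    refine le_trans (le_of_eq ?_) h
    rw [norm_sq_eq_sum_inner_row, Finset.sum_div]
    congr 1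
    exact Finset.sum_congr rfl fun i _ => by rw [hrow]; ring
  calc _ ≤ ∫⁻ v, (ENNReal.ofReal (1 - ∑ i, μ i) + ∑ i, ENNReal.ofReal (μ i) *
        ENNReal.ofReal (Real.exp ((inner ℝ (e i) v) ^ 2 / 8))) ∂(gauss n) := by
        refine lintegral_mono fun v => ?_
        refine (ENNReal.ofReal_le_ofReal (hJ v)).trans (le_of_eq ?_)
        rw [ENNReal.ofReal_add (by linarith) (Finset.sum_nonneg fun i _ =>
          mul_nonneg (hμ0 i) (Real.exp_pos _).le), ENNReal.ofReal_sum_of_nonneg (fun i _ =>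
          mul_nonneg (hμ0 i) (Real.exp_pos _).le)]
        simp only [ENNReal.ofReal_mul (hμ0 _)]
    _ ≤ ENNReal.ofReal (1 - ∑ i, μ i) + ∑ i, ENNReal.ofReal (μ i) * 2 := by
        rw [lintegral_add_left (by fun_prop), lintegral_finsetSum _ (by fun_prop)]
        simp only [lintegral_const, measure_univ, mul_one]
        gcongr with i
        rw [lintegral_const_mul _ (by fun_prop)]
        gcongr
        exact lintegral_exp_inner_sq_le (he1 i)
    _ = ENNReal.ofReal ((1 - ∑ i, μ i) + ∑ i, μ i * 2) := by
        rw [ENNReal.ofReal_add (by linarith) (Finset.sum_nonneg fun i _ =>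
          mul_nonneg (hμ0 i) zero_le_two), ENNReal.ofReal_sum_of_nonneg (fun i _ =>
          mul_nonneg (hμ0 i) zero_le_two)]
        simp only [ENNReal.ofReal_mul (hμ0 _), ENNReal.ofReal_ofNat]
    _ ≤ 2 := by
        refine ENNReal.ofReal_le_of_le_toReal ?_
        rw [← Finset.sum_mul, ENNReal.toReal_ofNat]
        linarith

/-- A pair of independent standard Gaussian vectors. -/
noncomputable abbrev gaussPair (n : ℕ) : Measure (E n × E n) := (gauss n).prod (gauss n)

/-- Conditionally on `v`, the form `⟨u, A v⟩` is Gaussian with variance `‖A v‖² ≤ ‖L v‖²`, so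
integrating over `u` first leaves an exponential of a quadratic form in `v`. -/
lemma lintegral_exp_abs_bilinear_le {m n : ℕ} {A : E n →L[ℝ] E n} {L : E n →L[ℝ] E m}
    (hAL : ∀ v, ‖A v‖ ≤ ‖L v‖) (hL : ‖cols L‖ ≤ 1) :
    ∫⁻ p, ENNReal.ofReal (Real.exp (|inner ℝ p.1 (A p.2)| / 2)) ∂(gaussPair n) ≤ 4 := by
  rw [lintegral_prod_symm' _ (by fun_prop)]
  calc _ ≤ ∫⁻ v, ENNReal.ofReal 2 * ENNReal.ofReal (Real.exp (‖L v‖ ^ 2 / 8)) ∂(gauss n) := by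
        refine lintegral_mono fun v => ?_
        simp only [real_inner_comm (A v)]
        refine (lintegral_exp_abs_inner_le (A v)).trans ?_
        rw [← ENNReal.ofReal_mul zero_le_two]
        refine ENNReal.ofReal_le_ofReal ?_
        have := hAL v
        gcongr
    _ ≤ ENNReal.ofReal 2 * 2 := by
        rw [lintegral_const_mul _ (by fun_prop)]
        gcongr
        exact lintegral_exp_norm_sq_le hL
    _ = 4 := by rw [ENNReal.ofReal_ofNat]; norm_num

lemma integrable_exp_abs_bilinear {m n : ℕ} {A : E n →L[ℝ] E n} {L : E n →L[ℝ] E m}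
    (hAL : ∀ v, ‖A v‖ ≤ ‖L v‖) (hL : ‖cols L‖ ≤ 1) :
    Integrable (fun p : E n × E n => Real.exp (|inner ℝ p.1 (A p.2)| / 2)) (gaussPair n) ∧
      ∫ p, Real.exp (|inner ℝ p.1 (A p.2)| / 2) ∂(gaussPair n) ≤ 4 := by
  have h := lintegral_exp_abs_bilinear_le hAL hL
  have hi : Integrable (fun p : E n × E n => Real.exp (|inner ℝ p.1 (A p.2)| / 2))
      (gaussPair n) := by
    refine ⟨Measurable.aestronglyMeasurable (by fun_prop), ?_⟩
    rw [hasFiniteIntegral_iff_ofReal (Filter.Eventually.of_forall fun _ => (Real.exp_pos _).le)]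
    exact h.trans_lt (by simp)
  refine ⟨hi, ?_⟩
  rw [integral_eq_lintegral_of_nonneg_ae (Filter.Eventually.of_forall fun _ => (Real.exp_pos _).le)
    hi.aestronglyMeasurable]
  exact ENNReal.toReal_le_of_le_ofReal (by norm_num) (h.trans (by simp))

lemma sq_le_exp_abs (t : ℝ) : t ^ 2 ≤ 8 * Real.exp (|t| / 2) := by
  have h := Real.pow_div_factorial_le_exp (|t| / 2) (by positivity) 2
  have : (|t| / 2) ^ 2 = t ^ 2 / 4 := by rw [div_pow, sq_abs]; norm_num
  rw [this] at h
  norm_num [Nat.factorial] at h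
  linarith

lemma pow_four_le_exp_abs (t : ℝ) : t ^ 4 ≤ 384 * Real.exp (|t| / 2) := by
  have h := Real.pow_div_factorial_le_exp (|t| / 2) (by positivity) 4
  have : (|t| / 2) ^ 4 = t ^ 4 / 16 := by
    rw [div_pow, show (4 : ℕ) = 2 * 2 by rfl, pow_mul, sq_abs, ← pow_mul]; norm_num
  rw [this] at h
  norm_num [Nat.factorial] at h
  linarith

lemma integral_bilinear_sq {n : ℕ} (A : E n →L[ℝ] E n) (hA : ‖cols A‖ ≤ 1) :
    ∫ p, (inner ℝ p.1 (A p.2)) ^ 2 ∂(gaussPair n) = ‖cols A‖ ^ 2 := by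
  have hi := (integrable_exp_abs_bilinear (A := A) (L := A) (fun _ => le_rfl) hA).1
  have hi2 : Integrable (fun p : E n × E n => (inner ℝ p.1 (A p.2) : ℝ) ^ 2) (gaussPair n) := by
    refine (hi.const_mul 8).mono' (Measurable.aestronglyMeasurable (by fun_prop)) ?_
    refine Filter.Eventually.of_forall fun p => ?_
    rw [Real.norm_eq_abs, abs_of_nonneg (sq_nonneg _)]
    exact sq_le_exp_abs _
  rw [integral_prod_symm _ hi2]
  simp only [real_inner_comm (A _), integral_inner_sq_gauss, norm_sq_eq_sum_inner_row]
  rw [integral_finsetSum]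
  · simp only [integral_inner_sq_gauss, sum_norm_row_sq]
  · intro i _
    have := IsGaussian.memLp_dual (gauss n) (innerSL ℝ (row A i)) 2 (by simp)
    exact this.integrable_sq

/-- The linear term is traded away so that the lower tail needs only the exact second moment and an
upper bound for the fourth. -/
lemma exp_neg_le_quartic {t : ℝ} (ht : 0 ≤ t) : Real.exp (-t) ≤ 1 - t ^ 2 / 2 + t ^ 4 := by
  have h1 : Real.exp (-t) ≤ 1 - t + t ^ 2 / 2 := by
    have h2 := Real.quadratic_le_exp_of_nonneg ht
    rw [Real.exp_neg]
    refine (inv_anti₀ (by positivity) h2).trans ?_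
    rw [inv_eq_one_div, div_le_iff₀ (by positivity)]
    nlinarith [sq_nonneg (t ^ 2)]
  have h3 : t ≤ 1 + t ^ 3 := by
    rcases le_total t 1 with h | h
    · have : 0 ≤ t ^ 3 := by positivity
      linarith
    · nlinarith [mul_nonneg ht (sub_nonneg.2 h)]
  nlinarith

/-- The second moment is `1` and the fourth at most `384 · 4`. At scale `1/80` the quadratic gain
`1/12800` beats the quartic loss, leaving at least `1/25600`. -/
lemma integral_exp_neg_abs_bilinear_le {n : ℕ} {A : E n →L[ℝ] E n} (hA : ‖cols A‖ = 1) :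
    ∫ p, Real.exp (-(1 / 80) * |inner ℝ p.1 (A p.2)|) ∂(gaussPair n) ≤
      1 - 1 / 25600 := by
  obtain ⟨hi, hi4⟩ := integrable_exp_abs_bilinear (A := A) (L := A) (fun _ => le_rfl) hA.le
  have hq := integral_bilinear_sq A hA.le
  have hi2 : Integrable (fun p : E n × E n => (inner ℝ p.1 (A p.2) : ℝ) ^ 2) (gaussPair n) := by
    by_contra h
    rw [integral_undef h, hA] at hq
    norm_num at hq
  have hi3 : Integrable (fun p : E n × E n => 1 - (inner ℝ p.1 (A p.2) : ℝ) ^ 2 / 12800)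
      (gaussPair n) := (integrable_const _).sub (hi2.div_const _)
  calc _ ≤ ∫ p, (1 - (inner ℝ p.1 (A p.2)) ^ 2 / 12800 +
        384 / 40960000 * Real.exp (|inner ℝ p.1 (A p.2)| / 2)) ∂(gaussPair n) := by
        refine integral_mono_of_nonneg (Filter.Eventually.of_forall fun _ => (Real.exp_pos _).le)
          (hi3.add (hi.const_mul _))
          (Filter.Eventually.of_forall fun p => ?_)
        set y : ℝ := inner ℝ p.1 (A p.2) with hy
        have h1 := exp_neg_le_quartic (t := 1 / 80 * |y|) (by positivity)
        have h2 : (1 / 80 * |y|) ^ 2 = y ^ 2 / 6400 := by rw [mul_pow, sq_abs]; ring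
        have h3 : (1 / 80 * |y|) ^ 4 = y ^ 4 / 40960000 := by
          rw [show (4 : ℕ) = 2 * 2 by rfl, pow_mul, h2]; ring
        rw [h2, h3] at h1
        have h4 := pow_four_le_exp_abs y
        change Real.exp (-(1 / 80) * |y|) ≤ 1 - y ^ 2 / 12800 +
          384 / 40960000 * Real.exp (|y| / 2)
        rw [neg_mul]
        linarith
    _ = 1 - 1 / 12800 + 384 / 40960000 *
          ∫ p, Real.exp (|inner ℝ p.1 (A p.2)| / 2) ∂(gaussPair n) := by
        rw [integral_add hi3 (hi.const_mul _),
          integral_sub (integrable_const _) (hi2.div_const _), integral_div, hq, hA,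
          integral_const_mul]
        simp
    _ ≤ 1 - 1 / 25600 := by linarith

end Gaussian

/-! ### Concentration and the uniform restricted isometry -/

section Concentration

open MeasureTheory ProbabilityTheory

/-- `N` independent pairs of independent standard Gaussian vectors. -/
noncomputable abbrev gaussPairs (N n : ℕ) : Measure (Fin N → E n × E n) :=
  Measure.pi fun _ => gaussPair n

lemma measurable_abs_bilinear {n : ℕ} (A : E n →L[ℝ] E n) :
    Measurable fun q : E n × E n => |(inner ℝ q.1 (A q.2) : ℝ)| := by
  have : Measurable fun q : E n × E n => (inner ℝ q.1 (A q.2) : ℝ) := by fun_prop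
  exact this.abs

lemma measurable_bilinearL1 {N n : ℕ} (A : E n →L[ℝ] E n) :
    Measurable fun p : Fin N → E n × E n => bilinearL1 p A :=
  Finset.measurable_sum _ fun i _ => (measurable_abs_bilinear A).comp (measurable_pi_apply i)

lemma mgf_bilinearL1 {N n : ℕ} (A : E n →L[ℝ] E n) (t : ℝ) :
    mgf (fun p => bilinearL1 p A) (gaussPairs N n) t =
      (∫ q, Real.exp (t * |inner ℝ q.1 (A q.2)|) ∂(gaussPair n)) ^ N := by
  set Z : Fin N → (Fin N → E n × E n) → ℝ := fun i p => |inner ℝ (p i).1 (A (p i).2)| with hZ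
  have hmeas : Measurable fun q : E n × E n => Real.exp (t * |(inner ℝ q.1 (A q.2) : ℝ)|) :=
    ((measurable_abs_bilinear A).const_mul t).exp
  have hind : iIndepFun Z (gaussPairs N n) :=
    iIndepFun_pi (μ := fun _ : Fin N => gaussPair n)
      (X := fun _ q => |(inner ℝ q.1 (A q.2) : ℝ)|)
      fun _ => (measurable_abs_bilinear A).aemeasurable
  have h1 : (fun p => bilinearL1 p A) = ∑ i, Z i := by
    ext p; simp [bilinearL1, hZ]
  rw [h1, hind.mgf_sum (fun i => (measurable_abs_bilinear A).comp (measurable_pi_apply i))]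
  have h2 : ∀ i, mgf (Z i) (gaussPairs N n) t =
      ∫ q, Real.exp (t * |inner ℝ q.1 (A q.2)|) ∂(gaussPair n) := by
    intro i
    exact ((measurePreserving_eval (fun _ : Fin N => gaussPair n) i).hasLaw).integral_comp
      hmeas.aestronglyMeasurable
  simp [h2]

/-- Chernoff at parameter `1/2` with `4 ≤ e^(3/2)` gives `e^(-N/2)`; the rate is weakened to match
the lower tail. -/
lemma measureReal_bilinearL1_ge_le {m N n : ℕ} {A : E n →L[ℝ] E n} {L : E n →L[ℝ] E m}
    (hAL : ∀ v, ‖A v‖ ≤ ‖L v‖) (hL : ‖cols L‖ ≤ 1) :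
    (gaussPairs N n).real {p | 4 * (N : ℝ) ≤ bilinearL1 p A} ≤ Real.exp (-(N / 51200)) := by
  have hmgf := mgf_bilinearL1 (N := N) A (1 / 2)
  obtain ⟨hi, hi4⟩ := integrable_exp_abs_bilinear hAL hL
  have heq : ∀ q : E n × E n, (1 / 2 : ℝ) * |inner ℝ q.1 (A q.2)| = |inner ℝ q.1 (A q.2)| / 2 :=
    fun q => by ring
  simp only [heq] at hmgf
  have hpos := integral_exp_pos hi
  have hint : Integrable (fun p => Real.exp (1 / 2 * bilinearL1 p A)) (gaussPairs N n) := by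
    by_contra h
    rw [mgf, integral_undef h] at hmgf
    exact (pow_pos hpos N).ne hmgf
  refine (measure_ge_le_exp_mul_mgf _ (by norm_num) hint).trans ?_
  have h4 : (4 : ℝ) ≤ Real.exp (3 / 2) := by
    have h5 := Real.exp_one_gt_d9
    have h6 : Real.exp (3 / 2) ^ 2 = Real.exp 1 ^ 3 := by
      rw [← Real.exp_nat_mul, ← Real.exp_nat_mul]; norm_num
    have h7 : (2.7 : ℝ) ^ 3 ≤ Real.exp 1 ^ 3 := pow_le_pow_left₀ (by norm_num) (by linarith) 3
    exact le_of_sq_le_sq (by rw [h6]; refine le_trans ?_ h7; norm_num) (Real.exp_pos _).le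
  rw [hmgf]
  calc _ ≤ Real.exp (-(1 / 2) * (4 * N)) * Real.exp (3 / 2) ^ N := by
        gcongr
        exact hi4.trans h4
    _ = Real.exp (-(N / 2)) := by
        rw [← Real.exp_nat_mul, ← Real.exp_add]; congr 1; ring
    _ ≤ _ := Real.exp_le_exp.2 (by
        have : (0 : ℝ) ≤ N := by positivity
        linarith)

/-- Chernoff at parameter `-1/80`: the threshold costs `N/51200`, half of the gain `N/25600`. -/
lemma measureReal_bilinearL1_le_le {N n : ℕ} {A : E n →L[ℝ] E n} (hA : ‖cols A‖ = 1) :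
    (gaussPairs N n).real {p | bilinearL1 p A ≤ N / 640} ≤ Real.exp (-(N / 51200)) := by
  have hint : Integrable (fun p => Real.exp (-(1 / 80) * bilinearL1 p A)) (gaussPairs N n) := by
    refine Integrable.of_bound
      (((measurable_bilinearL1 A).const_mul _).exp).aestronglyMeasurable 1
      (Filter.Eventually.of_forall fun p => ?_)
    rw [Real.norm_eq_abs, Real.abs_exp, Real.exp_le_one_iff]
    have := bilinearL1_nonneg p A
    linarith
  refine (measure_le_le_exp_mul_mgf _ (by norm_num) hint).trans ?_
  rw [mgf_bilinearL1]
  calc _ ≤ Real.exp (-(-(1 / 80)) * (N / 640)) * Real.exp (-(1 / 25600)) ^ N := by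
        gcongr
        refine (integral_exp_neg_abs_bilinear_le hA).trans ?_
        have := Real.add_one_le_exp (-(1 / 25600 : ℝ))
        linarith
    _ = _ := by rw [← Real.exp_nat_mul, ← Real.exp_add]; congr 1; ring

lemma measureReal_bilinearL1_lt_le {N n : ℕ} (A : E n →L[ℝ] E n) :
    (gaussPairs N n).real {p | bilinearL1 p A < N / 640 * ‖cols A‖} ≤
      Real.exp (-(N / 51200)) := by
  rcases eq_or_ne (cols A) 0 with h | h
  · have : {p : Fin N → E n × E n | bilinearL1 p A < N / 640 * ‖cols A‖} = ∅ := by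
      ext p
      simp [h, bilinearL1_nonneg]
    rw [this, measureReal_empty]
    exact (Real.exp_pos _).le
  · have hn : 0 < ‖cols A‖ := norm_pos_iff.2 h
    have h1 : ‖cols (‖cols A‖⁻¹ • A)‖ = 1 := by
      rw [cols_smul, norm_smul, norm_inv, norm_norm, inv_mul_cancel₀ hn.ne']
    refine (measureReal_mono ?_).trans (measureReal_bilinearL1_le_le h1)
    intro p hp
    simp only [Set.mem_ofPred_eq] at hp ⊢
    rw [bilinearL1_smul, abs_of_nonneg (by positivity), inv_mul_eq_div, div_le_iff₀ hn]
    exact hp.le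

/-- With overwhelming probability, Gaussian bilinear measurements are equivalent to the Frobenius
norm on linear maps of rank at most `m`. -/
theorem exists_restricted_isometry_event (m n N : ℕ) :
    ∃ B : Set (Fin N → E n × E n), MeasurableSet B ∧
      (gaussPairs N n).real B ≤ 2 * 50001 ^ (2 * (m * n)) * Real.exp (-(N / 51200)) ∧
      ∀ p ∉ B, ∀ A : E n →L[ℝ] E n,
        Module.finrank ℝ (LinearMap.range (A : E n →ₗ[ℝ] E n)) ≤ m →
        (N : ℝ) / 1280 * ‖cols A‖ ≤ bilinearL1 p A ∧ bilinearL1 p A ≤ 8 * N * ‖cols A‖ := by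
  obtain ⟨T, hT1, hT, hTc⟩ := exists_net_unitBall (FactorSpace m n) (ε := 1 / 25000) (by norm_num)
  set B₁ : FactorSpace m n → Set (Fin N → E n × E n) :=
    fun t => {p | 4 * (N : ℝ) ≤ bilinearL1 p t.prod}
  set B₂ : FactorSpace m n → Set (Fin N → E n × E n) :=
    fun t => {p | bilinearL1 p t.prod < N / 640 * ‖cols t.prod‖}
  refine ⟨⋃ t ∈ T, (B₁ t ∪ B₂ t), ?_, ?_, ?_⟩
  · exact Finset.measurableSet_biUnion _ fun t _ =>
      (measurableSet_le measurable_const (measurable_bilinearL1 _)).union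
        (measurableSet_lt (measurable_bilinearL1 _) measurable_const)
  -- Union bound over the net, whose size is `(1 + 2 · 25000)` to the power `2mn`.
  · calc _ ≤ ∑ t ∈ T, (gaussPairs N n).real (B₁ t ∪ B₂ t) := measureReal_biUnion_finset_le _ _
      _ ≤ ∑ t ∈ T, 2 * Real.exp (-((N : ℝ) / 51200)) := by
        refine Finset.sum_le_sum fun t ht => (measureReal_union_le _ _).trans ?_
        have h1 : (gaussPairs N n).real (B₁ t) ≤ Real.exp (-(N / 51200)) := by
          refine measureReal_bilinearL1_ge_le (L := ofCols m n t.2) (fun v => ?_) ?_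
          · refine (t.1.le_opNorm _).trans (mul_le_of_le_one_left (norm_nonneg _) ?_)
            exact (norm_fst_le t).trans (hT1 t ht)
          · rw [cols_ofCols]
            exact (norm_snd_le t).trans (hT1 t ht)
        have h2 : (gaussPairs N n).real (B₂ t) ≤ Real.exp (-(N / 51200)) :=
          measureReal_bilinearL1_lt_le _
        linarith
      _ = T.card * (2 * Real.exp (-((N : ℝ) / 51200))) := by simp
      _ ≤ 50001 ^ (2 * (m * n)) * (2 * Real.exp (-((N : ℝ) / 51200))) := by
        rw [finrank_factorSpace] at hTc
        refine mul_le_mul_of_nonneg_right (hTc.trans (le_of_eq ?_)) (by positivity)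
        norm_num
      _ = _ := by ring
  · intro p hp A hA
    simp only [Set.mem_iUnion, not_exists, Set.mem_union, not_or] at hp
    refine restricted_isometry_of_net p (Nat.cast_nonneg N) T hT1 hT (fun t ht => ?_)
      (fun t ht => ?_) A hA
    · exact (not_le.1 (hp t ht).1).le
    · exact not_lt.1 (hp t ht).2

/-- Independent standard Gaussian vectors, grouped into pairs and rotated by `π / 4`, are again
pairs of independent standard Gaussian vectors. -/
theorem hasLaw_rotated_pairs {N n : ℕ} {Ω : Type*} [MeasurableSpace Ω] {P : Measure Ω}
    [IsProbabilityMeasure P] {a : Fin N ⊕ Fin N → Ω → E n} (hind : iIndepFun a P)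
    (hlaw : ∀ s, HasLaw (a s) (gauss n) P) :
    HasLaw (fun ω (i : Fin N) => ContinuousLinearMap.rotation (Real.pi / 4)
      (a (Sum.inl i) ω, a (Sum.inr i) ω)) (gaussPairs N n) P := by
  have h1 : HasLaw (fun ω s => a s ω) (Measure.pi fun _ => gauss n) P := by
    refine ⟨aemeasurable_pi_iff.2 fun s => (hlaw s).aemeasurable, ?_⟩
    rw [(iIndepFun_iff_map_fun_eq_pi_map fun s => (hlaw s).aemeasurable).1 hind]
    simp only [(hlaw _).map_eq]
  have h2 := (measurePreserving_sumPiEquivProdPi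
    (fun _ : Fin N ⊕ Fin N => gauss n)).comp_hasLaw h1
  have h3 := ((measurePreserving_arrowProdEquivProdArrow (E n) (E n) (Fin N)
    (fun _ => gauss n) (fun _ => gauss n)).symm _).comp_hasLaw h2
  have hrot : MeasurePreserving (ContinuousLinearMap.rotation (E := E n) (Real.pi / 4))
      (gaussPair n) (gaussPair n) :=
    ⟨by fun_prop, IsGaussian.map_rotation_eq_self integral_id_stdGaussian _⟩
  exact (measurePreserving_pi (fun _ : Fin N => gaussPair n) (fun _ => gaussPair n)
    fun _ => hrot).comp_hasLaw h3

end Concentration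

/-! ### From bilinear back to quadratic measurements -/

lemma norm_cols_toEuclideanCLM_sq {n : ℕ} (A : Matrix (Fin n) (Fin n) ℝ) :
    ‖cols (Matrix.toEuclideanCLM (n := Fin n) (𝕜 := ℝ) A)‖ = √(frobSq A) := by
  rw [eq_comm, Real.sqrt_eq_iff_eq_sq (frobSq_nonneg A) (norm_nonneg _), PiLp.norm_sq_eq_of_L2,
    frobSq_eq_sum]
  refine Finset.sum_congr rfl fun j _ => ?_
  rw [EuclideanSpace.norm_sq_eq]
  refine Finset.sum_congr rfl fun i _ => ?_
  simp [cols]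

lemma finrank_range_toEuclideanCLM {n : ℕ} (A : Matrix (Fin n) (Fin n) ℝ) :
    Module.finrank ℝ (LinearMap.range
      (Matrix.toEuclideanCLM (n := Fin n) (𝕜 := ℝ) A : E n →ₗ[ℝ] E n)) = A.rank := by
  rw [Matrix.rank_eq_finrank_range_toLin A (PiLp.basisFun 2 ℝ (Fin n)) (PiLp.basisFun 2 ℝ (Fin n)),
    Matrix.coe_toEuclideanCLM_eq_toEuclideanLin, Matrix.toEuclideanLin, Matrix.toLpLin_eq_toLin]

/-- The rotated vectors are, up to sign, `(x + y)/√2` and `(x - y)/√2`. Symmetry of `D` cancels the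
mixed terms and leaves a combination of the two quadratic values. -/
lemma inner_rotation_eq_zero {n : ℕ} {D : Matrix (Fin n) (Fin n) ℝ} (hD : D.IsSymm) {x y : E n}
    (hx : quadMeasurement x D = 0) (hy : quadMeasurement y D = 0) :
    inner ℝ (ContinuousLinearMap.rotation (Real.pi / 4) (x, y)).1
      (Matrix.toEuclideanCLM (n := Fin n) (𝕜 := ℝ) D
        (ContinuousLinearMap.rotation (Real.pi / 4) (x, y)).2) = (0 : ℝ) := by
  set T := Matrix.toEuclideanCLM (n := Fin n) (𝕜 := ℝ) D
  have hin : ∀ u v : E n, inner ℝ u (T v) = u.ofLp ⬝ᵥ D.mulVec v.ofLp :=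
    Matrix.inner_toEuclideanCLM D
  have hsymm : (inner ℝ y (T x) : ℝ) = inner ℝ x (T y) := by
    rw [hin, hin, Matrix.dotProduct_mulVec, ← Matrix.mulVec_transpose, hD.eq, dotProduct_comm]
  have hx' : (inner ℝ x (T x) : ℝ) = 0 := by rw [hin]; exact hx
  have hy' : (inner ℝ y (T y) : ℝ) = 0 := by rw [hin]; exact hy
  rw [ContinuousLinearMap.rotation_apply, Real.cos_pi_div_four, Real.sin_pi_div_four]
  simp only [map_add, map_smul, inner_add_left, inner_add_right, inner_smul_left,
    inner_smul_right, hx', hy', hsymm, conj_trivial]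
  ring

/-- Restricted isometry of the rotated pairs of measurement vectors excludes all nonzero symmetric
perturbations with vanishing measurements. -/
theorem exists_isContraction_of_bilinear_isometry {n N M : ℕ} (hN : 0 < N)
    {X : Matrix (Fin n) (Fin n) ℝ} (hX : X.IsSymm) (hr : 0 < X.rank) (a : Fin M → E n)
    (g : Fin N ⊕ Fin N → Fin M) {p : Fin N → E n × E n}
    (hp : ∀ i, p i = ContinuousLinearMap.rotation (Real.pi / 4)
      (a (g (Sum.inl i)), a (g (Sum.inr i))))
    (hA : ∀ A : E n →L[ℝ] E n,
      Module.finrank ℝ (LinearMap.range (A : E n →ₗ[ℝ] E n)) ≤ 2 * X.rank + 2 ^ 29 * X.rank →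
        (N : ℝ) / 1280 * ‖cols A‖ ≤ bilinearL1 p A ∧ bilinearL1 p A ≤ 8 * N * ‖cols A‖)
    {D : Matrix (Fin n) (Fin n) ℝ} (hD : D.IsSymm) (hD0 : D ≠ 0)
    (hDa : ∀ i, quadMeasurement (a i) D = 0) :
    ∃ W, IsContraction W ∧ Wᵀ = W ∧ traceNorm X < (W * (X + D)).trace := by
  have hN' : (0 : ℝ) < N := by exact_mod_cast hN
  have hr' : (0 : ℝ) < X.rank := by exact_mod_cast hr
  refine exists_isContraction_of_restricted_isometry hX hD hD0
    (Φ := fun A => bilinearL1 p (Matrix.toEuclideanCLM (n := Fin n) (𝕜 := ℝ) A))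
    (c := N / 1280) (C := 8 * N) (k := 2 ^ 29 * X.rank) (by positivity) (by positivity)
    (fun A B => ?_) (fun A => ?_) (fun A hAr => ?_) (fun A hAr => ?_) ?_ ?_
  · rw [map_add]; exact bilinearL1_add_le _ _ _
  · rw [map_neg, ← neg_one_smul ℝ, bilinearL1_smul]; simp
  · rw [← norm_cols_toEuclideanCLM_sq]
    exact (hA _ (by rw [finrank_range_toEuclideanCLM]; exact hAr)).1
  · rw [← norm_cols_toEuclideanCLM_sq]
    exact (hA _ (by rw [finrank_range_toEuclideanCLM]; exact hAr.trans (Nat.le_add_left _ _))).2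
  -- The isometry ratio is `C/c = 8 · 1280 = 10240`; the block size `k = 2²⁹ r` is chosen so that
  -- `√(k/r)` exceeds it.
  · have h1 : (10240 : ℝ) < √536870912 := Real.lt_sqrt_of_sq_lt (by norm_num)
    have h2 : 0 < √(X.rank : ℝ) := Real.sqrt_pos.2 hr'
    rw [Nat.cast_mul, Real.sqrt_mul (by positivity)]
    push_cast
    have h3 := mul_lt_mul_of_pos_right h1 (mul_pos hN' h2)
    nlinarith
  · refine le_of_eq (Finset.sum_eq_zero fun i _ => ?_)
    rw [hp i, inner_rotation_eq_zero hD (hDa _) (hDa _), abs_zero]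

/-- The net contributes about `1.2 · 10¹⁰ n r` to the exponent, while the tail contributes about
`M/102400 ≥ 9.7 · 10¹⁰ n r`; the surplus pays for `10⁻⁶ M`. -/
lemma failure_bound_lt {n r M : ℕ} (hn : 0 < n) (hr : 0 < r)
    (hM : (10 : ℝ) ^ 16 * n * r ≤ M) :
    2 * 50001 ^ (2 * ((2 * r + 2 ^ 29 * r) * n)) * Real.exp (-((M / 2 : ℕ) / 51200)) <
      Real.exp (-(10⁻¹ ^ 6 * M)) := by
  have h1 : (2 : ℝ) ≤ Real.exp 1 := by have := Real.exp_one_gt_d9; linarith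
  have h2 : (50001 : ℝ) ≤ Real.exp 11 := by
    have h5 := Real.exp_one_gt_d9
    have h6 : Real.exp 11 = Real.exp 1 ^ 11 := by rw [← Real.exp_nat_mul]; norm_num
    rw [h6]
    refine le_trans ?_ (pow_le_pow_left₀ (by norm_num) (show (2.7 : ℝ) ≤ Real.exp 1 by linarith) 11)
    norm_num
  have hz : (1 : ℝ) ≤ n * r := by exact_mod_cast Nat.mul_pos hn hr
  have hN : (M : ℝ) ≤ 2 * (M / 2 : ℕ) + 1 := by
    have : M ≤ 2 * (M / 2) + 1 := by omega
    exact_mod_cast this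
  calc _ ≤ Real.exp 1 * Real.exp 11 ^ (2 * ((2 * r + 2 ^ 29 * r) * n)) *
        Real.exp (-((M / 2 : ℕ) / 51200)) := by gcongr
    _ = Real.exp (1 + (2 * ((2 * r + 2 ^ 29 * r) * n)) * 11 - (M / 2 : ℕ) / 51200) := by
        rw [← Real.exp_nat_mul, ← Real.exp_add, ← Real.exp_add]
        push_cast
        congr 1
        ring
    _ < _ := by
        refine Real.exp_lt_exp.2 ?_
        have h3 : (2 * ((2 * (r : ℝ) + 2 ^ 29 * r) * n)) * 11 = 11811160108 * (n * r) := by ring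
        rw [h3]
        rw [mul_assoc] at hM
        norm_num at hM ⊢
        linarith

lemma isSymm_hessian {n : ℕ} {f : E n → ℝ} {L : ℝ} (hf : HasLipschitzHessian f L) (x : E n) :
    (hessian f x).IsSymm := by
  ext i j
  simp only [Matrix.transpose_apply, hessian, Matrix.of_apply]
  exact second_derivative_symmetric (fun y => (hf.1 y).hasFDerivAt) (hf.2.1 x).hasFDerivAt _ _

end HessianRecovery

/-! ### Assembly -/

theorem theorem2 :
    ∃ K₁ > (0 : ℝ), ∃ K₂ > (0 : ℝ),
      ∀ (n r M : ℕ) (f : HessianRecovery.E n → ℝ) (L₂ : ℝ) (x : HessianRecovery.E n)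
        (Ω : Type*) [MeasurableSpace Ω] (P : MeasureTheory.Measure Ω)
        [MeasureTheory.IsProbabilityMeasure P] (a : Fin M → Ω → HessianRecovery.E n),
        0 < L₂ →
        HessianRecovery.HasLipschitzHessian f L₂ →
        (HessianRecovery.hessian f x).rank = r →
        ProbabilityTheory.iIndepFun a P →
        (∀ i, ProbabilityTheory.HasLaw (a i)
          (ProbabilityTheory.stdGaussian (HessianRecovery.E n)) P) →
        K₁ * n * r ≤ M →
        ∃ S : Set Ω, MeasurableSet S ∧ 1 - Real.exp (-(K₂ * M)) < P.real S ∧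
          ∀ ω ∈ S,
            HessianRecovery.IsSolution (fun i => a i ω)
              (fun i => HessianRecovery.quadMeasurement (a i ω) (HessianRecovery.hessian f x))
              (HessianRecovery.hessian f x) ∧
            ∀ H : Matrix (Fin n) (Fin n) ℝ,
              HessianRecovery.IsSolution (fun i => a i ω)
                (fun i => HessianRecovery.quadMeasurement (a i ω)
                  (HessianRecovery.hessian f x)) H →
              (1 / 2 : ℝ) • (H + H.transpose) = HessianRecovery.hessian f x ∧
              (H.IsSymm ∨ (HessianRecovery.hessian f x).PosSemidef ∨
                  (-HessianRecovery.hessian f x).PosSemidef →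
                H = HessianRecovery.hessian f x) := by
  refine ⟨10 ^ 16, by norm_num, 10⁻¹ ^ 6, by norm_num, ?_⟩
  intro n r M f L₂ x Ω _ P _ a _ hf hr hind hlaw hM
  set X := HessianRecovery.hessian f x with hXdef
  have hX : X.IsSymm := HessianRecovery.isSymm_hessian hf x
  rcases Nat.eq_zero_or_pos r with h0 | hrpos
  · refine ⟨Set.univ, MeasurableSet.univ, ?_, fun ω _ => ?_⟩
    · rw [MeasureTheory.probReal_univ]
      have := Real.exp_pos (-(10⁻¹ ^ 6 * (M : ℝ)))
      linarith
    · exact HessianRecovery.recovery_of_isContraction hX _ fun D hD hD0 _ =>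
        HessianRecovery.exists_isContraction_of_rank_eq_zero hX hD hD0 (hr.trans h0)
  have hn : 0 < n := by
    have := X.rank_le_width
    omega
  have hz : (1 : ℝ) ≤ n * r := by exact_mod_cast Nat.mul_pos hn hrpos
  have hM2 : 2 ≤ M := by
    have : (2 : ℝ) ≤ M := by
      rw [mul_assoc] at hM
      norm_num at hM
      linarith
    exact_mod_cast this
  -- Only the first `2N` vectors are paired; a leftover one can be dropped since vanishing on the
  -- pairs already excludes `D`.
  set N := M / 2 with hN
  have hNpos : 0 < N := by omega
  let g : Fin N ⊕ Fin N → Fin M := fun s => Fin.castLE (by omega) (finSumFinEquiv s)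
  have hg : Function.Injective g :=
    (Fin.castLE_injective _).comp finSumFinEquiv.injective
  obtain ⟨B, hBm, hBP, hB⟩ :=
    HessianRecovery.exists_restricted_isometry_event (2 * r + 2 ^ 29 * r) n N
  have hpair := HessianRecovery.hasLaw_rotated_pairs (a := fun s => a (g s))
    (hind.precomp hg) (fun s => hlaw (g s))
  set p : Ω → Fin N → HessianRecovery.E n × HessianRecovery.E n := fun ω i =>
    ContinuousLinearMap.rotation (Real.pi / 4) (a (g (Sum.inl i)) ω, a (g (Sum.inr i)) ω)
  -- The pairs are only almost everywhere measurable in `ω`, so the bad event is replaced by a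
  -- measurable hull of the same measure.
  have hbad : P.real (MeasureTheory.toMeasurable P (p ⁻¹' B)) <
      Real.exp (-(10⁻¹ ^ 6 * (M : ℝ))) := by
    refine lt_of_le_of_lt ?_ (HessianRecovery.failure_bound_lt hn hrpos hM)
    rw [MeasureTheory.measureReal_def, MeasureTheory.measure_toMeasurable]
    refine le_trans (le_of_eq ?_) hBP
    rw [MeasureTheory.measureReal_def]
    exact congrArg ENNReal.toReal (hpair.measure_eq (p := fun q => q ∈ B) hBm)
  refine ⟨(MeasureTheory.toMeasurable P (p ⁻¹' B))ᶜ,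
    (MeasureTheory.measurableSet_toMeasurable _ _).compl, ?_, fun ω hω => ?_⟩
  · rw [MeasureTheory.probReal_compl_eq_one_sub (MeasureTheory.measurableSet_toMeasurable _ _)]
    linarith
  · have hωB : p ω ∉ B := fun h => hω (MeasureTheory.subset_toMeasurable P _ h)
    refine HessianRecovery.recovery_of_isContraction hX _ fun D hD hD0 hDa => ?_
    refine HessianRecovery.exists_isContraction_of_bilinear_isometry hNpos hX
      (by rw [hr]; exact hrpos) (fun i => a i ω) g (p := p ω) (fun i => rfl) ?_ hD hD0 hDa
    rw [hr]
    exact hB _ hωB
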